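/- Let $m\in\{0,1,2,\dots\}$, $\nu=m+\tfrac12$, $b>0$, $\alpha>1$, and assume $\frac1{\alpha-1}>m+\frac32$ (which is exactly the condition for the integral below to converge). Put $z=\frac{(\alpha-1)b^2}{4}$. Let $(a)_r=a(a+1)\cdots(a+r-1)$, $(a)_0=1$, be the Pochhammer symbol, $\psi=\Gamma'/\Gamma$ the psi function, and ${}_1F_2(a;c,d;x)=\sum_{r\ge0}\frac{(a)_r}{(c)_r(d)_r}\frac{x^r}{r!}$. Then the integral $$I_{1\alpha}=\int_0^\infty x^{\nu}\,[1+(\alpha-1)x]^{-\frac1{\alpha-1}}\,e^{-bx^{-1/2}}\,dx$$ and the infinite series below converge absolutely, and $$I_{1\alpha}=\frac{\pi^{-1/2}}{(\alpha-1)^{m+\frac32}\,\Gamma\!\left(\frac1{\alpha-1}\right)}\Bigg\{\pi^{1/2}\,\Gamma\!\left(\tfrac1{\alpha-1}-\tfrac32-m\right)\Gamma\!\left(\tfrac32+m\right)\,{}_1F_2\!\left(\tfrac1{\alpha-1}-\tfrac32-m;\ \tfrac12,\,-\tfrac12-m;\ -z\right)$$ $$-\,2\pi^{1/2}\,\Gamma\!\left(\tfrac1{\alpha-1}-1-m\right)\Gamma(1+m)\,z^{1/2}\sum_{r=0}^{m}\frac{(-1)^r}{r!}\,\frac{\left(\frac1{\alpha-1}-1-m\right)_r}{\left(\frac32\right)_r(-m)_r}\,z^r\;+\;z^{m+\frac32}\sum_{r=0}^{\infty}z^r\,\big[-\ln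 z+C_r\big]\,D_r\Bigg\},$$ where $$C_r=\psi\!\left(-m-\tfrac32-r\right)-\psi\!\left(\tfrac1{\alpha-1}+r\right)+\psi(1+r)+\psi(2+m+r),$$ $$D_r=\frac{(-1)^{1+m+r}\,\Gamma\!\left(-m-\frac32\right)\Gamma\!\left(\frac1{\alpha-1}\right)\left(\frac1{\alpha-1}\right)_r}{\left(\frac52+m\right)_r\,r!\,(1+m+r)!}.$$ -/

import Mathlib

open MeasureTheory Set
open scoped Nat

noncomputable section

/-- The Pochhammer symbol `(a)_r = a (a + 1) ⋯ (a + r - 1)`, with `(a)_0 = 1`. -/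
def poch (a : ℝ) (r : ℕ) : ℝ := (ascPochhammer ℝ r).eval a

/-- The psi function on the real line: the logarithmic derivative `Γ' / Γ` of the gamma function,
at positive and at negative non-integer arguments. -/
def psi (x : ℝ) : ℝ := deriv Real.Gamma x / Real.Gamma x

/-- The `r`-th term of the series `₁F₂(a; c, d; z)`. -/
def hyp1F2Term (a c d z : ℝ) (r : ℕ) : ℝ :=
  poch a r / (poch c r * poch d r) * (z ^ r / (r ! : ℝ))

/-- The generalized hypergeometric function `₁F₂(a; c, d; z)`. -/
def hyp1F2 (a c d z : ℝ) : ℝ := ∑' r : ℕ, hyp1F2Term a c d z r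

/-- The integrand `x ^ ν [1 + (α - 1) x] ^ (-1 / (α - 1)) exp (-b x ^ (-1/2))` of the extended
(pathway) non-resonant thermonuclear function. -/
def I1Integrand (ν α b x : ℝ) : ℝ :=
  x ^ ν * (1 + (α - 1) * x) ^ (-(1 / (α - 1))) * Real.exp (-b * x ^ (-(1 / 2) : ℝ))

/-- The extended thermonuclear function `I_{1α}` (with `a = 1`, `ρ = 1/2`, `γ - 1 = ν`). -/
def I1 (ν α b : ℝ) : ℝ := ∫ x in Ioi (0 : ℝ), I1Integrand ν α b x

/-- The series variable `(α - 1) b² / 4`. -/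
def seriesVar (α b : ℝ) : ℝ := (α - 1) * b ^ 2 / 4

/-- The coefficient `C_r`. -/
def coeffC (m : ℕ) (α : ℝ) (r : ℕ) : ℝ :=
  psi (-(m : ℝ) - 3 / 2 - r) - psi (1 / (α - 1) + r) + psi (1 + r) + psi (2 + m + r)

/-- The coefficient `D_r`. -/
def coeffD (m : ℕ) (α : ℝ) (r : ℕ) : ℝ :=
  (-1) ^ (1 + m + r) * Real.Gamma (-(m : ℝ) - 3 / 2) * Real.Gamma (1 / (α - 1))
      * poch (1 / (α - 1)) r
    / (poch (5 / 2 + m) r * (r ! : ℝ) * ((1 + m + r)! : ℝ))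

/-- The `r`-th term of the logarithmic series. -/
def logTerm (m : ℕ) (α b : ℝ) (r : ℕ) : ℝ :=
  seriesVar α b ^ r * (-Real.log (seriesVar α b) + coeffC m α r) * coeffD m α r

end

open Filter Topology

/-! ### The psi function -/

/-! Put A = 1/(α-1), k = 2 z^{1/2} = b (α-1)^{1/2} and t = (α-1)x. Up to the factor
(α-1)^{-(m+3/2)}, the integral becomes F_n(k) = ∫_0^∞ t^{n/2-1} (1+t)^{-A} exp(-k t^{-1/2}) dt with
n = 2m+3. Expanding the exponential termwise gives, formally, Σ_j (-k)^j/j! · Γ((n-j)/2)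
Γ(A-(n-j)/2)/Γ(A). For j = n+2i the first gamma factor has a pole, and the term must be replaced by
a multiple of k^{n+2i} times -2 log k plus psi values. The candidate G_n (`pathwayExpansion`) is the
power series with Γ read as 0 at its poles, plus this logarithmic series.

The equality F_n = G_n is proved without contour integrals, by differential equations in k. Both
families satisfy F_n' = -F_{n-1}, and for n ≥ 1 both tend to the same beta value as k → 0+, so
equality passes from n to n+1 (`pathwayIntegral_eq`).

The base case n = 0 comes from a closed system. Writing the parameter A explicitly, X = F_0(A), Y =
F_2(A+1), Z = -F_1(A+1) satisfy X' = -2A Y/k, Y' = Z, Z' = X - Y: the first equation is an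
integration by parts, the last is 1+t = 1 + (t). The series G satisfy the same relations. Both F_0
and G_0 behave like -2 log k - 3γ - ψ(A) at the origin (`tendsto_pathwayIntegral_zero_add_log`,
`tendsto_logSeries_zero_add_log`), so the differences tend to 0, and `eq_zero_of_singular_system`
makes X vanish.

For n = 2m+3 the even j then give ₁F₂, the odd j ≤ 2m+1 give the finite sum, and the remaining odd
powers carry the logarithmic series; duplication and reflection of psi bring its coefficients to the
stated form. -/

theorem psi_add_one {x : ℝ} (hx : ∀ m : ℕ, x ≠ -m) : psi (x + 1) = psi x + 1 / x := by
  have hx0 : x ≠ 0 := by simpa using hx 0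
  have hG := Real.Gamma_ne_zero hx
  have h1 : HasDerivAt (fun y : ℝ => Real.Gamma (y + 1)) (deriv Real.Gamma (x + 1)) x := by
    have hd : DifferentiableAt ℝ Real.Gamma (x + 1) := by
      refine Real.differentiableAt_Gamma fun m h => hx (m + 1) ?_
      push_cast; linarith
    exact hd.hasDerivAt.comp_add_const x 1
  have h2 : HasDerivAt (fun y : ℝ => y * Real.Gamma y)
      (1 * Real.Gamma x + x * deriv Real.Gamma x) x :=
    (hasDerivAt_id x).mul (Real.differentiableAt_Gamma hx).hasDerivAt
  have h3 : (fun y : ℝ => Real.Gamma (y + 1)) =ᶠ[𝓝 x] fun y => y * Real.Gamma y := by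
    filter_upwards [isOpen_ne.mem_nhds hx0] with y hy using Real.Gamma_add_one hy
  have h4 := h1.unique (h2.congr_of_eventuallyEq h3)
  unfold psi
  rw [h4, Real.Gamma_add_one hx0]
  field_simp
  ring

theorem psi_add_one_of_pos {x : ℝ} (hx : 0 < x) : psi (x + 1) = psi x + 1 / x :=
  psi_add_one fun m h => by
    have : (0 : ℝ) ≤ m := m.cast_nonneg
    linarith

theorem psi_one : psi 1 = -Real.eulerMascheroniConstant := by
  simp [psi, Real.hasDerivAt_Gamma_one.deriv]

theorem psi_one_half : psi (1 / 2) = -Real.eulerMascheroniConstant - 2 * Real.log 2 := by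
  have : √Real.pi ≠ 0 := (Real.sqrt_pos.2 Real.pi_pos).ne'
  rw [psi, Real.hasDerivAt_Gamma_one_half.deriv, Real.Gamma_one_half_eq]
  field_simp
  ring

/-- Reflection of the psi function at half-integers. -/
theorem psi_half_sub_nat (N : ℕ) : psi (1 / 2 - N) = psi (1 / 2 + N) := by
  induction N with
  | zero => simp
  | succ N ih =>
    have h1 : psi (1 / 2 + N + 1) = psi (1 / 2 + N) + 1 / (1 / 2 + N) :=
      psi_add_one_of_pos (by positivity)
    have h2 : psi (1 / 2 - (N + 1) + 1) = psi (1 / 2 - (N + 1)) + 1 / (1 / 2 - ((N : ℝ) + 1)) := by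
      refine psi_add_one fun m h => ?_
      have h' : ((2 * m + 1 : ℕ) : ℝ) = ((2 * (N + 1) : ℕ) : ℝ) := by push_cast; linarith
      have := Nat.cast_injective (R := ℝ) h'
      omega
    rw [show (1 / 2 : ℝ) - (N + 1) + 1 = 1 / 2 - N by ring, ih] at h2
    push_cast
    rw [← add_assoc, h1, h2]
    have h3 : (1 / 2 - ((N : ℝ) + 1)) = -(1 / 2 + N) := by ring
    rw [h3, div_neg]
    ring

/-- Duplication of the psi function at positive integers. -/
theorem psi_nat_duplication (N : ℕ) :
    2 * psi (2 * N + 2) = psi (N + 1) + psi (N + 3 / 2) + 2 * Real.log 2 := by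
  induction N with
  | zero =>
    have h1 : psi (1 + 1) = psi 1 + 1 / 1 := psi_add_one_of_pos one_pos
    have h2 : psi (1 / 2 + 1) = psi (1 / 2) + 1 / (1 / 2) := psi_add_one_of_pos (by norm_num)
    norm_num at h1 h2 ⊢
    rw [h1, h2, psi_one, psi_one_half]
    ring
  | succ N ih =>
    have hN : (0 : ℝ) ≤ N := N.cast_nonneg
    have h1 : psi (2 * N + 2 + 1) = psi (2 * N + 2) + 1 / (2 * N + 2) :=
      psi_add_one_of_pos (by positivity)
    have h2 : psi (2 * N + 2 + 1 + 1) = psi (2 * N + 2 + 1) + 1 / (2 * N + 2 + 1) :=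
      psi_add_one_of_pos (by positivity)
    have h3 : psi (N + 1 + 1) = psi (N + 1) + 1 / (N + 1) := psi_add_one_of_pos (by positivity)
    have h4 : psi (N + 3 / 2 + 1) = psi (N + 3 / 2) + 1 / (N + 3 / 2) :=
      psi_add_one_of_pos (by positivity)
    push_cast
    rw [show (2 * ((N : ℝ) + 1) + 2) = 2 * N + 2 + 1 + 1 by ring, h2, h1, h3,
      show (N : ℝ) + 1 + 3 / 2 = N + 3 / 2 + 1 by ring, h4]
    have : 2 * (psi (2 * N + 2) + 1 / (2 * N + 2) + 1 / (2 * N + 2 + 1))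
      = 2 * psi (2 * N + 2) + 1 / ((N : ℝ) + 1) + 1 / (N + 3 / 2) := by field_simp; ring
    rw [this, ih]
    ring

/-- Each unit step adds at most 1/x. This crude linear growth suffices against the factorials of the
logarithmic series. -/
theorem abs_psi_add_nat_le {x : ℝ} (hx : 0 < x) (i : ℕ) : |psi (x + i)| ≤ |psi x| + i / x := by
  induction i with
  | zero => simp
  | succ i ih =>
    have hi : 0 < x + i := by positivity
    have h1 := psi_add_one_of_pos hi
    push_cast
    rw [← add_assoc, h1]
    have h2 : 1 / (x + i) ≤ 1 / x := one_div_le_one_div_of_le hx (by simp)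
    have h3 : |1 / (x + i)| = 1 / (x + i) := abs_of_pos (by positivity)
    have := abs_add_le (psi (x + i)) (1 / (x + i))
    rw [add_div]
    linarith

/-! ### A uniqueness theorem for a singular system of differential equations -/

theorem nonneg_of_hasDerivAt_nonneg_of_tendsto_zero {g g' : ℝ → ℝ} {K : ℝ}
    (hg : ∀ x, 0 < x → HasDerivAt g (g' x) x) (hg' : ∀ x, 0 < x → x ≤ K → 0 ≤ g' x)
    (h0 : Tendsto g (𝓝[>] 0) (𝓝 0)) {x : ℝ} (hx : 0 < x) (hxK : x ≤ K) : 0 ≤ g x := by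
  have hm : MonotoneOn g (Ioc 0 K) := by
    refine monotoneOn_of_deriv_nonneg (convex_Ioc 0 K)
      (fun y hy => (hg y hy.1).continuousAt.continuousWithinAt) ?_ ?_
    · intro y hy
      rw [interior_Ioc] at hy
      exact (hg y hy.1).differentiableAt.differentiableWithinAt
    · intro y hy
      rw [interior_Ioc] at hy
      rw [(hg y hy.1).deriv]
      exact hg' y hy.1 hy.2.le
  refine le_of_tendsto h0 ?_
  filter_upwards [Ioo_mem_nhdsGT hx] with y hy
  exact hm ⟨hy.1, hy.2.le.trans hxK⟩ ⟨hx, hxK⟩ hy.2.le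

/-- Both c x^{p+1} + f and c x^{p+1} - f are nondecreasing on (0, K] with limit 0 at the origin,
hence nonnegative. This is one step of a Picard iteration, with no integral. -/
theorem abs_le_pow_of_hasDerivAt {f f' : ℝ → ℝ} {K c : ℝ} {p : ℕ}
    (hf : ∀ x, 0 < x → HasDerivAt f (f' x) x)
    (hf' : ∀ x, 0 < x → x ≤ K → |f' x| ≤ c * (p + 1) * x ^ p)
    (h0 : Tendsto f (𝓝[>] 0) (𝓝 0)) {x : ℝ} (hx : 0 < x) (hxK : x ≤ K) :
    |f x| ≤ c * x ^ (p + 1) := by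
  have hp : ∀ y : ℝ, HasDerivAt (fun y : ℝ => c * y ^ (p + 1)) (c * (p + 1) * y ^ p) y := by
    intro y
    refine ((hasDerivAt_pow (p + 1) y).const_mul c).congr_deriv ?_
    rw [Nat.add_sub_cancel]
    push_cast
    ring
  have hp0 : Tendsto (fun y : ℝ => c * y ^ (p + 1)) (𝓝[>] 0) (𝓝 0) := by
    have : Tendsto (fun y : ℝ => c * y ^ (p + 1)) (𝓝 0) (𝓝 (c * 0 ^ (p + 1))) :=
      (hp 0).continuousAt.tendsto
    simp only [ne_eq, Nat.add_eq_zero_iff, one_ne_zero, and_false, not_false_eq_true, zero_pow,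
      mul_zero] at this
    exact this.mono_left nhdsWithin_le_nhds
  rw [abs_le]
  constructor
  · have := nonneg_of_hasDerivAt_nonneg_of_tendsto_zero (K := K)
      (g := fun y => c * y ^ (p + 1) + f y) (fun y hy => (hp y).add (hf y hy))
      (fun y hy hyK => by have := abs_le.1 (hf' y hy hyK); linarith)
      (by simpa using hp0.add h0) hx hxK
    linarith
  · have := nonneg_of_hasDerivAt_nonneg_of_tendsto_zero (K := K)
      (g := fun y => c * y ^ (p + 1) - f y) (fun y hy => (hp y).sub (hf y hy))
      (fun y hy hyK => by have := abs_le.1 (hf' y hy hyK); linarith)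
      (by simpa using hp0.sub h0) hx hxK
    linarith

theorem exists_abs_le_of_tendsto_zero {f : ℝ → ℝ} (hf : ∀ x, 0 < x → ContinuousAt f x)
    (h0 : Tendsto f (𝓝[>] 0) (𝓝 0)) (K : ℝ) : ∃ C, ∀ x, 0 < x → x ≤ K → |f x| ≤ C := by
  have h1 : ∀ᶠ x in 𝓝[>] (0 : ℝ), |f x| < 1 := by
    have := h0.abs
    rw [abs_zero] at this
    exact this.eventually (gt_mem_nhds one_pos)
  obtain ⟨δ, hδ, h2⟩ := (mem_nhdsGT_iff_exists_Ioo_subset).1 h1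
  obtain ⟨C, hC⟩ := (isCompact_Icc (a := δ) (b := K)).exists_bound_of_continuousOn
    (f := f) fun x hx => (hf x (lt_of_lt_of_le hδ hx.1)).continuousWithinAt
  refine ⟨max C 1, fun x hx hxK => ?_⟩
  rcases lt_or_ge x δ with h | h
  · exact (h2 ⟨hx, h⟩ : |f x| < 1).le.trans (le_max_right _ _)
  · exact (hC x ⟨h, hxK⟩).trans (le_max_left _ _)

/-- The solutions are bounded near 0, and iterating the equations gives bounds C (Bx)^p / p! for
every p, which tend to 0. The factor 1/k does no harm because Y, as a primitive of Z, is one order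
smaller than X and Z. -/
theorem eq_zero_of_singular_system {X Y Z : ℝ → ℝ} {a : ℝ}
    (hX : ∀ k, 0 < k → HasDerivAt X (a * Y k / k) k)
    (hY : ∀ k, 0 < k → HasDerivAt Y (Z k) k)
    (hZ : ∀ k, 0 < k → HasDerivAt Z (X k - Y k) k)
    (hX0 : Tendsto X (𝓝[>] 0) (𝓝 0)) (hY0 : Tendsto Y (𝓝[>] 0) (𝓝 0))
    (hZ0 : Tendsto Z (𝓝[>] 0) (𝓝 0)) {k : ℝ} (hk : 0 < k) : X k = 0 := by
  obtain ⟨C1, hC1⟩ := exists_abs_le_of_tendsto_zero (fun x hx => (hX x hx).continuousAt) hX0 k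
  obtain ⟨C2, hC2⟩ := exists_abs_le_of_tendsto_zero (fun x hx => (hY x hx).continuousAt) hY0 k
  obtain ⟨C3, hC3⟩ := exists_abs_le_of_tendsto_zero (fun x hx => (hZ x hx).continuousAt) hZ0 k
  set C := max C1 (max C2 C3)
  have hC : 0 ≤ C := ((abs_nonneg _).trans (hC1 k hk le_rfl)).trans (le_max_left _ _)
  set B := |a| + 2
  have hB : 0 ≤ B := by positivity
  have key : ∀ p : ℕ, ∀ x, 0 < x → x ≤ k → |X x| ≤ C * B ^ p / p ! * x ^ p ∧
      |Y x| ≤ C * B ^ p / p ! * x ^ p ∧ |Z x| ≤ C * B ^ p / p ! * x ^ p := by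
    intro p
    induction p with
    | zero =>
      intro x hx hxk
      simp only [pow_zero, Nat.factorial_zero, Nat.cast_one, mul_one, div_one]
      exact ⟨(hC1 x hx hxk).trans (le_max_left _ _),
        (hC2 x hx hxk).trans ((le_max_left _ _).trans (le_max_right _ _)),
        (hC3 x hx hxk).trans ((le_max_right _ _).trans (le_max_right _ _))⟩
    | succ p ih =>
      set D := C * B ^ p / p ! with hD
      have hD0 : 0 ≤ D := by positivity
      have hp1 : (0 : ℝ) < p + 1 := by positivity
      have hS : C * B ^ (p + 1) / (p + 1)! = D * B / (p + 1) := by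
        rw [hD, Nat.factorial_succ]; push_cast; field_simp; ring
      rw [hS]
      -- The extra power of x and the factor 1/(p+1) here compensate the singular 1/k in the
      -- equation for X.
      have hYb : ∀ x, 0 < x → x ≤ k → |Y x| ≤ D / (p + 1) * x ^ (p + 1) := by
        intro x hx hxk
        refine abs_le_pow_of_hasDerivAt hY (fun y hy hyk => ?_) hY0 hx hxk
        rw [div_mul_cancel₀ _ hp1.ne']
        exact (ih y hy hyk).2.2
      intro x hx hxk
      refine ⟨?_, ?_, ?_⟩
      · refine abs_le_pow_of_hasDerivAt hX (fun y hy hyk => ?_) hX0 hx hxk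
        rw [div_mul_cancel₀ _ hp1.ne', abs_div, abs_mul, abs_of_pos hy, div_le_iff₀ hy]
        have h1 : D / (p + 1) ≤ D := div_le_self hD0 (by linarith)
        calc |a| * |Y y| ≤ B * (D / (p + 1) * y ^ (p + 1)) := by
              gcongr
              · simp [B]
              · exact hYb y hy hyk
          _ ≤ B * (D * y ^ (p + 1)) := by gcongr
          _ = D * B * y ^ p * y := by ring
      · refine (hYb x hx hxk).trans ?_
        gcongr
        exact le_mul_of_one_le_right hD0 (by have := abs_nonneg a; simp only [B]; linarith)
      · refine abs_le_pow_of_hasDerivAt hZ (fun y hy hyk => ?_) hZ0 hx hxk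
        rw [div_mul_cancel₀ _ hp1.ne']
        obtain ⟨h1, h2, -⟩ := ih y hy hyk
        calc |X y - Y y| ≤ |X y| + |Y y| := abs_sub _ _
          _ ≤ D * 2 * y ^ p := by linarith
          _ ≤ D * B * y ^ p := by
            gcongr
            simp [B]
  have hlim : Tendsto (fun p : ℕ => C * ((B * k) ^ p / p !)) atTop (𝓝 (C * 0)) :=
    (FloorSemiring.tendsto_pow_div_factorial_atTop (B * k)).const_mul C
  have hle : |X k| ≤ C * 0 := by
    refine ge_of_tendsto' hlim fun p => ?_
    have := (key p k hk le_rfl).1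
    rw [mul_pow]
    calc _ ≤ _ := this
      _ = _ := by ring
  rw [mul_zero] at hle
  exact abs_nonpos_iff.1 hle

/-! ### The beta integral over the half-line -/

theorem integrableOn_and_integral_beta_Ioo {p q : ℝ} (hp : 0 < p) (hq : 0 < q) :
    IntegrableOn (fun u : ℝ => u ^ (p - 1) * (1 - u) ^ (q - 1)) (Ioo 0 1) ∧
    ∫ u in Ioo (0 : ℝ) 1, u ^ (p - 1) * (1 - u) ^ (q - 1)
      = Real.Gamma p * Real.Gamma q / Real.Gamma (p + q) := by
  have hc : IntegrableOn (fun x : ℝ => (x : ℂ) ^ ((p : ℂ) - 1) * (1 - (x : ℂ)) ^ ((q : ℂ) - 1))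
      (Ioo 0 1) := by
    have := Complex.betaIntegral_convergent (u := p) (v := q) (by simpa) (by simpa)
    rwa [intervalIntegrable_iff_integrableOn_Ioo_of_le zero_le_one] at this
  have he : ∀ x ∈ Ioo (0 : ℝ) 1,
      ((x : ℂ) ^ ((p : ℂ) - 1) * (1 - (x : ℂ)) ^ ((q : ℂ) - 1)).re
        = x ^ (p - 1) * (1 - x) ^ (q - 1) := by
    intro x hx
    have h1 : (x : ℂ) ^ ((p : ℂ) - 1) = ((x ^ (p - 1) : ℝ) : ℂ) := by
      rw [Complex.ofReal_cpow hx.1.le]; push_cast; rfl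
    have h2 : (1 - (x : ℂ)) ^ ((q : ℂ) - 1) = (((1 - x) ^ (q - 1) : ℝ) : ℂ) := by
      rw [Complex.ofReal_cpow (by linarith [hx.2])]; push_cast; rfl
    rw [h1, h2, ← Complex.ofReal_mul, Complex.ofReal_re]
  refine ⟨(IntegrableOn.congr_fun hc.re he measurableSet_Ioo), ?_⟩
  have h3 : (∫ x in Ioo (0 : ℝ) 1, ((x : ℂ) ^ ((p : ℂ) - 1) * (1 - (x : ℂ)) ^ ((q : ℂ) - 1)).re)
      = (∫ x in Ioo (0 : ℝ) 1, (x : ℂ) ^ ((p : ℂ) - 1) * (1 - (x : ℂ)) ^ ((q : ℂ) - 1)).re :=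
    integral_re hc
  rw [← setIntegral_congr_fun measurableSet_Ioo he, h3, ← integral_Ioc_eq_integral_Ioo,
    ← intervalIntegral.integral_of_le zero_le_one]
  exact (ProbabilityTheory.beta_eq_betaIntegralReal p q hp hq).symm

theorem image_div_one_sub_Ioo : (fun u : ℝ => u / (1 - u)) '' Ioo 0 1 = Ioi 0 := by
  ext t
  constructor
  · rintro ⟨u, hu, rfl⟩
    exact div_pos hu.1 (by linarith [hu.2])
  · intro (ht : 0 < t)
    have h1 : 0 < 1 + t := by linarith
    refine ⟨t / (1 + t), ⟨div_pos ht h1, (div_lt_one h1).2 (by linarith)⟩, ?_⟩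
    field_simp
    ring

/-- The substitution t = u/(1-u) turns this into the Euler beta integral with parameters p and A -
p. -/
theorem integrableOn_and_integral_beta_Ioi {p A : ℝ} (hp : 0 < p) (hpA : p < A) :
    IntegrableOn (fun t : ℝ => t ^ (p - 1) * (1 + t) ^ (-A)) (Ioi 0) ∧
    ∫ t in Ioi (0 : ℝ), t ^ (p - 1) * (1 + t) ^ (-A)
      = Real.Gamma p * Real.Gamma (A - p) / Real.Gamma A := by
  have hd : ∀ u ∈ Ioo (0 : ℝ) 1,
      HasDerivWithinAt (fun u : ℝ => u / (1 - u)) (1 / (1 - u) ^ 2) (Ioo 0 1) u := by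
    intro u hu
    have h1 : 1 - u ≠ 0 := by linarith [hu.2]
    refine HasDerivAt.hasDerivWithinAt ?_
    refine ((hasDerivAt_id u).div ((hasDerivAt_const u (1 : ℝ)).sub (hasDerivAt_id u))
      h1).congr_deriv ?_
    simp
  have hinj : InjOn (fun u : ℝ => u / (1 - u)) (Ioo 0 1) := by
    intro u hu v hv h
    have h1 : 1 - u ≠ 0 := by linarith [hu.2]
    have h2 : 1 - v ≠ 0 := by linarith [hv.2]
    simp only at h
    field_simp at h
    linarith
  have he : ∀ u ∈ Ioo (0 : ℝ) 1, |1 / (1 - u) ^ 2| •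
      ((u / (1 - u)) ^ (p - 1) * (1 + u / (1 - u)) ^ (-A))
        = u ^ (p - 1) * (1 - u) ^ (A - p - 1) := by
    intro u hu
    have h1 : 0 < 1 - u := by linarith [hu.2]
    have h2 : 1 + u / (1 - u) = (1 - u)⁻¹ := by field_simp; ring
    have h3 : |1 / (1 - u) ^ 2| = (1 - u) ^ (-2 : ℝ) := by
      rw [abs_of_pos (by positivity), Real.rpow_neg h1.le, one_div]
      norm_cast
    rw [h2, h3, smul_eq_mul, Real.div_rpow hu.1.le h1.le, Real.inv_rpow h1.le, Real.rpow_neg h1.le A,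
      inv_inv, show A - p - 1 = -2 + -(p - 1) + A by ring, Real.rpow_add h1, Real.rpow_add h1,
      Real.rpow_neg h1.le (p - 1)]
    ring
  obtain ⟨hI, hE⟩ := integrableOn_and_integral_beta_Ioo hp (sub_pos.2 hpA)
  rw [← image_div_one_sub_Ioo]
  constructor
  · rw [integrableOn_image_iff_integrableOn_abs_deriv_smul measurableSet_Ioo hd hinj]
    exact hI.congr_fun (fun u hu => (he u hu).symm) measurableSet_Ioo
  · rw [integral_image_eq_integral_abs_deriv_smul measurableSet_Ioo hd hinj,
      setIntegral_congr_fun measurableSet_Ioo he, hE]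
    congr 2
    ring

/-! ### The pathway integral -/

/-- The integrand `t ^ (p - 1) (1 + t) ^ (-A) exp (-k t ^ (-1/2))`. -/
noncomputable def pathwayIntegrand (p A k t : ℝ) : ℝ :=
  t ^ (p - 1) * (1 + t) ^ (-A) * Real.exp (-k * t ^ (-(1 / 2) : ℝ))

/-- The integral of `t ^ (p - 1) (1 + t) ^ (-A) exp (-k t ^ (-1/2))` over the half-line. -/
noncomputable def pathwayIntegral (p A k : ℝ) : ℝ := ∫ t in Ioi (0 : ℝ), pathwayIntegrand p A k t

theorem measurable_pathwayIntegrand (p A k : ℝ) : Measurable (pathwayIntegrand p A k) := by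
  unfold pathwayIntegrand
  fun_prop

theorem pathwayIntegrand_nonneg (p A k : ℝ) {t : ℝ} (ht : 0 < t) :
    0 ≤ pathwayIntegrand p A k t := by
  unfold pathwayIntegrand
  positivity

/-- Raise y ≤ exp y, at y = ku/s, to the power s. The constant is not sharp. -/
theorem rpow_mul_exp_neg_le {s k u : ℝ} (hs : 0 < s) (hk : 0 < k) (hu : 0 < u) :
    u ^ s * Real.exp (-k * u) ≤ (s / k) ^ s := by
  have h1 : k * u / s ≤ Real.exp (k * u / s) := by
    linarith [Real.add_one_le_exp (k * u / s)]
  have h2 : (k * u / s) ^ s ≤ Real.exp (k * u) := by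
    calc (k * u / s) ^ s ≤ Real.exp (k * u / s) ^ s := by gcongr
      _ = Real.exp (k * u) := by rw [← Real.exp_mul]; congr 1; field_simp
  have h3 : u ^ s = (s / k) ^ s * (k * u / s) ^ s := by
    rw [← Real.mul_rpow (by positivity) (by positivity)]
    congr 1
    field_simp
  rw [h3, mul_assoc]
  refine mul_le_of_le_one_right (by positivity) ?_
  calc (k * u / s) ^ s * Real.exp (-k * u) ≤ Real.exp (k * u) * Real.exp (-k * u) := by gcongr
    _ = 1 := by rw [← Real.exp_add]; simp

theorem integrableOn_pathwayIntegrand {p A k : ℝ} (hA : 0 < A) (hpA : p < A) (hk : 0 < k) :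
    IntegrableOn (pathwayIntegrand p A k) (Ioi 0) := by
  -- The exponential absorbs a factor t^{-q} for any q > 0, so p may be shifted to p + q inside (0,
  -- A), where the beta integral converges; this also covers p ≤ 0.
  obtain ⟨q, hq0, hq1, hq2⟩ : ∃ q, 0 < q ∧ 0 < p + q ∧ p + q < A := by
    rcases lt_or_ge 0 p with h | h
    · exact ⟨(A - p) / 2, by linarith, by linarith, by linarith⟩
    · exact ⟨-p + A / 2, by linarith, by linarith, by linarith⟩
  have hI := ((integrableOn_and_integral_beta_Ioi hq1 hq2).1).const_mul ((2 * q / k) ^ (2 * q))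
  refine hI.mono' (measurable_pathwayIntegrand p A k).aestronglyMeasurable ?_
  refine ae_restrict_of_forall_mem measurableSet_Ioi fun t (ht : 0 < t) => ?_
  rw [Real.norm_of_nonneg (pathwayIntegrand_nonneg p A k ht), pathwayIntegrand]
  have h1 := rpow_mul_exp_neg_le (s := 2 * q) (k := k) (u := t ^ (-(1 / 2) : ℝ)) (by linarith) hk
    (by positivity)
  rw [← Real.rpow_mul ht.le, show (-(1 / 2) : ℝ) * (2 * q) = -q by ring] at h1
  have h2 : t ^ (p - 1) = t ^ (p + q - 1) * t ^ (-q) := by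
    rw [← Real.rpow_add ht]; congr 1; ring
  rw [h2]
  calc t ^ (p + q - 1) * t ^ (-q) * (1 + t) ^ (-A) * Real.exp (-k * t ^ (-(1 / 2) : ℝ))
      = t ^ (p + q - 1) * (1 + t) ^ (-A) * (t ^ (-q) * Real.exp (-k * t ^ (-(1 / 2) : ℝ))) := by
        ring
    _ ≤ t ^ (p + q - 1) * (1 + t) ^ (-A) * (2 * q / k) ^ (2 * q) := by gcongr
    _ = _ := by ring

theorem pathwayIntegrand_le_beta {p A k t : ℝ} (hk : 0 ≤ k) (ht : 0 < t) :
    pathwayIntegrand p A k t ≤ t ^ (p - 1) * (1 + t) ^ (-A) := by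
  unfold pathwayIntegrand
  refine mul_le_of_le_one_right (by positivity) (Real.exp_le_one_iff.2 ?_)
  have : 0 ≤ k * t ^ (-(1 / 2) : ℝ) := by positivity
  linarith

theorem hasDerivAt_pathwayIntegral {p A k : ℝ} (hA : 0 < A) (hpA : p < A) (hk : 0 < k) :
    HasDerivAt (pathwayIntegral p A) (-pathwayIntegral (p - 1 / 2) A k) k := by
  have hk2 : 0 < k / 2 := by linarith
  -- The integrand decreases in the exponential parameter, so its value at k/2 dominates on the
  -- whole neighbourhood (k/2, ∞).
  have key := hasDerivAt_integral_of_dominated_loc_of_deriv_le (μ := volume.restrict (Ioi (0 : ℝ)))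
    (F := pathwayIntegrand p A) (F' := fun k t => -pathwayIntegrand (p - 1 / 2) A k t)
    (bound := pathwayIntegrand (p - 1 / 2) A (k / 2)) (x₀ := k) (Ioi_mem_nhds (by linarith : k / 2 < k))
    (Eventually.of_forall fun x => (measurable_pathwayIntegrand p A x).aestronglyMeasurable)
    (integrableOn_pathwayIntegrand hA hpA hk)
    (measurable_pathwayIntegrand _ A k).neg.aestronglyMeasurable
    (ae_restrict_of_forall_mem measurableSet_Ioi fun t (ht : 0 < t) x (hx : k / 2 < x) => ?_)
    (integrableOn_pathwayIntegrand hA (by linarith) hk2)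
    (ae_restrict_of_forall_mem measurableSet_Ioi fun t (ht : 0 < t) x _ => ?_)
  · have := key.2
    rw [integral_neg] at this
    exact this
  · rw [norm_neg, Real.norm_of_nonneg (pathwayIntegrand_nonneg _ A x ht)]
    unfold pathwayIntegrand
    gcongr
  · unfold pathwayIntegrand
    have h1 : HasDerivAt (fun x : ℝ => -x * t ^ (-(1 / 2) : ℝ)) (-1 * t ^ (-(1 / 2) : ℝ)) x :=
      ((hasDerivAt_id x).neg).mul_const _
    refine (h1.exp.const_mul (t ^ (p - 1) * (1 + t) ^ (-A))).congr_deriv ?_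
    have h2 : t ^ (p - 1 / 2 - 1) = t ^ (p - 1) * t ^ (-(1 / 2) : ℝ) := by
      rw [← Real.rpow_add ht]; congr 1; ring
    rw [h2]
    ring

theorem tendsto_pathwayIntegral_zero {p A : ℝ} (hp : 0 < p) (hpA : p < A) :
    Tendsto (pathwayIntegral p A) (𝓝[>] 0)
      (𝓝 (Real.Gamma p * Real.Gamma (A - p) / Real.Gamma A)) := by
  obtain ⟨hI, hE⟩ := integrableOn_and_integral_beta_Ioi hp hpA
  rw [← hE]
  refine tendsto_integral_filter_of_dominated_convergence _ ?_ ?_ hI ?_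
  · exact Eventually.of_forall fun k => (measurable_pathwayIntegrand p A k).aestronglyMeasurable
  · filter_upwards [self_mem_nhdsWithin] with k (hk : 0 < k)
    refine ae_restrict_of_forall_mem measurableSet_Ioi fun t (ht : 0 < t) => ?_
    rw [Real.norm_of_nonneg (pathwayIntegrand_nonneg p A k ht)]
    exact pathwayIntegrand_le_beta hk.le ht
  · refine ae_of_all _ fun t => ?_
    have : Continuous fun k : ℝ =>
        t ^ (p - 1) * (1 + t) ^ (-A) * Real.exp (-k * t ^ (-(1 / 2) : ℝ)) := by fun_prop
    have := this.tendsto 0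
    simp only [neg_zero, zero_mul, Real.exp_zero, mul_one] at this
    exact this.mono_left nhdsWithin_le_nhds

/-- Split (1+t)^{-A} = (1+t)^{-(A+1)} (1+t). This relation closes the system of differential
equations. -/
theorem pathwayIntegral_zero_add_one {A k : ℝ} (hA : 0 < A) (hk : 0 < k) :
    pathwayIntegral 0 (A + 1) k = pathwayIntegral 0 A k - pathwayIntegral 1 (A + 1) k := by
  unfold pathwayIntegral
  rw [← integral_sub (integrableOn_pathwayIntegrand hA hA hk)
    (integrableOn_pathwayIntegrand (by linarith) (by linarith) hk)]
  refine setIntegral_congr_fun measurableSet_Ioi fun t (ht : 0 < t) => ?_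
  have h1 : (0 : ℝ) < 1 + t := by linarith
  have h2 : (1 + t) ^ (-A) = (1 + t) ^ (-(A + 1)) * (1 + t) := by
    rw [← Real.rpow_add_one h1.ne']; congr 1; ring
  have h3 : t ^ ((1 : ℝ) - 1) = t ^ ((0 : ℝ) - 1) * t := by
    rw [← Real.rpow_add_one ht.ne']; congr 1; ring
  simp only [pathwayIntegrand]
  rw [h2, h3]
  ring

/-- Integration by parts: k t^{-3/2} exp(-k t^{-1/2}) is the derivative of 2 exp(-k t^{-1/2}). The
boundary terms vanish, at 0 through the exponential and at infinity through (1+t)^{-A}. -/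
theorem mul_pathwayIntegral_neg_half {A k : ℝ} (hA : 0 < A) (hk : 0 < k) :
    k * pathwayIntegral (-(1 / 2)) A k = 2 * A * pathwayIntegral 1 (A + 1) k := by
  have hu : ∀ t ∈ Ioi (0 : ℝ), HasDerivAt (fun t : ℝ => (1 + t) ^ (-A))
      (-A * (1 + t) ^ (-(A + 1))) t := by
    intro t ht
    have h1 : (1 + t) ≠ 0 := by have : 0 < t := ht; linarith
    have h0 : HasDerivAt (fun t : ℝ => 1 + t) 1 t := (hasDerivAt_id t).const_add 1
    refine (h0.rpow_const (p := -A) (Or.inl h1)).congr_deriv ?_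
    rw [show -A - 1 = -(A + 1) by ring]
    ring
  have hv : ∀ t ∈ Ioi (0 : ℝ), HasDerivAt (fun t : ℝ => 2 * Real.exp (-k * t ^ (-(1 / 2) : ℝ)))
      (k * (t ^ (-(1 / 2) - 1 : ℝ) * Real.exp (-k * t ^ (-(1 / 2) : ℝ)))) t := by
    intro t (ht : 0 < t)
    refine ((((Real.hasDerivAt_rpow_const (p := (-(1 / 2) : ℝ)) (Or.inl ht.ne')).const_mul
      (-k)).exp).const_mul 2).congr_deriv ?_
    ring
  have hb : ∀ t : ℝ, 0 < t → Real.exp (-k * t ^ (-(1 / 2) : ℝ)) ≤ 1 := by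
    intro t ht
    have : 0 ≤ k * t ^ (-(1 / 2) : ℝ) := by positivity
    exact Real.exp_le_one_iff.2 (by linarith)
  have h1 := integral_Ioi_mul_deriv_eq_deriv_mul (a := 0) (a' := 0) (b' := 0) hu hv ?_ ?_ ?_ ?_
  · unfold pathwayIntegral
    rw [← integral_const_mul, ← integral_const_mul]
    rw [sub_zero, zero_sub, ← integral_neg] at h1
    convert h1 using 1
    · refine setIntegral_congr_fun measurableSet_Ioi fun t (ht : 0 < t) => ?_
      simp only [pathwayIntegrand]
      ring
    · refine setIntegral_congr_fun measurableSet_Ioi fun t (ht : 0 < t) => ?_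
      simp only [pathwayIntegrand, sub_self, Real.rpow_zero]
      ring
  · refine IntegrableOn.congr_fun ((integrableOn_pathwayIntegrand hA
      (by linarith : (-(1 / 2)) < A) hk).const_mul k) (fun t _ => ?_) measurableSet_Ioi
    simp only [pathwayIntegrand, Pi.mul_apply]
    ring
  · refine IntegrableOn.congr_fun ((integrableOn_pathwayIntegrand (by linarith)
      (by linarith : 1 < A + 1) hk).const_mul (-2 * A)) (fun t _ => ?_) measurableSet_Ioi
    simp only [pathwayIntegrand, Pi.mul_apply, sub_self, Real.rpow_zero]
    ring
  · have hlim : Tendsto (fun t : ℝ => 2 * Real.exp (-k * t ^ (-(1 / 2) : ℝ))) (𝓝[>] 0) (𝓝 0) := by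
      have h2 : Tendsto (fun t : ℝ => t ^ (-(1 / 2) : ℝ)) (𝓝[>] 0) atTop :=
        tendsto_rpow_neg_nhdsGT_zero (by norm_num)
      have h3 : Tendsto (fun t : ℝ => -k * t ^ (-(1 / 2) : ℝ)) (𝓝[>] 0) atBot :=
        h2.const_mul_atTop_of_neg (by linarith)
      simpa using (Real.tendsto_exp_atBot.comp h3).const_mul 2
    refine squeeze_zero' ?_ ?_ hlim
    · filter_upwards [self_mem_nhdsWithin] with t (ht : 0 < t)
      simp only [Pi.mul_apply]
      positivity
    · filter_upwards [self_mem_nhdsWithin] with t (ht : 0 < t)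
      simp only [Pi.mul_apply]
      refine mul_le_of_le_one_left (by positivity) ?_
      exact Real.rpow_le_one_of_one_le_of_nonpos (by linarith) (by linarith)
  · have hlim : Tendsto (fun t : ℝ => (1 + t) ^ (-A) * 2) atTop (𝓝 0) := by
      have h2 : Tendsto (fun t : ℝ => 1 + t) atTop atTop := tendsto_atTop_add_const_left _ _ tendsto_id
      simpa using ((tendsto_rpow_neg_atTop hA).comp h2).mul_const 2
    refine squeeze_zero' ?_ ?_ hlim
    · filter_upwards [eventually_gt_atTop 0] with t ht
      simp only [Pi.mul_apply]
      positivity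
    · filter_upwards [eventually_gt_atTop 0] with t ht
      simp only [Pi.mul_apply]
      have := hb t ht
      gcongr
      linarith

/-! ### The logarithmic singularity of the pathway integral at the origin -/

/-- `t⁻¹ (f t - 1)` for `t < 1` and `t⁻¹ f t` for `t ≥ 1`. -/
noncomputable def regularized (f : ℝ → ℝ) (t : ℝ) : ℝ := t⁻¹ * (f t - (Iio (1 : ℝ)).indicator 1 t)

theorem measurable_regularized {f : ℝ → ℝ} (hf : Measurable f) : Measurable (regularized f) :=
  measurable_inv.mul (hf.sub (measurable_one.indicator measurableSet_Iio))

theorem integrableOn_rpow_indicator {δ : ℝ} (hδ : 0 < δ) :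
    IntegrableOn (fun t : ℝ => t ^ (δ - 1) * (Iio (1 : ℝ)).indicator 1 t) (Ioi 0) ∧
    ∫ t in Ioi (0 : ℝ), t ^ (δ - 1) * (Iio (1 : ℝ)).indicator 1 t = 1 / δ := by
  have he : (fun t : ℝ => t ^ (δ - 1) * (Iio (1 : ℝ)).indicator 1 t)
      = (Iio (1 : ℝ)).indicator fun t => t ^ (δ - 1) := by
    ext t
    by_cases h : t ∈ Iio (1 : ℝ) <;> simp [h]
  have hI : IntegrableOn (fun t : ℝ => t ^ (δ - 1)) (Ioo 0 1) := by
    have := intervalIntegral.intervalIntegrable_rpow' (a := 0) (b := 1) (r := δ - 1) (by linarith)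
    rwa [intervalIntegrable_iff_integrableOn_Ioo_of_le zero_le_one] at this
  rw [he]
  constructor
  · rw [integrableOn_indicator_iff measurableSet_Iio]
    rwa [Iio_inter_Ioi]
  · rw [setIntegral_indicator measurableSet_Iio, Ioi_inter_Iio, ← integral_Ioc_eq_integral_Ioo,
      ← intervalIntegral.integral_of_le zero_le_one, integral_rpow (Or.inl (by linarith))]
    simp [hδ.ne']

/-- Since 1/δ is the integral of t^{δ-1} over (0, 1), the difference is the integral of t^δ times
the regularized function. It is dominated by C on (0, 1) and by t^{δ₀-1} f(t) beyond. -/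
theorem integrableOn_and_tendsto_regularized {f : ℝ → ℝ} {C δ₀ : ℝ} (hf : Measurable f)
    (hδ₀ : 0 < δ₀) (hf0 : ∀ t, 0 < t → 0 ≤ f t) (hf1 : ∀ t, 0 < t → t < 1 → |f t - 1| ≤ C * t)
    (hint : ∀ δ, 0 < δ → δ ≤ δ₀ → IntegrableOn (fun t => t ^ (δ - 1) * f t) (Ioi 0)) :
    IntegrableOn (regularized f) (Ioi 0) ∧
    Tendsto (fun δ => (∫ t in Ioi (0 : ℝ), t ^ (δ - 1) * f t) - 1 / δ) (𝓝[>] 0)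
      (𝓝 (∫ t in Ioi (0 : ℝ), regularized f t)) := by
  have hC : 0 ≤ C := by
    have := (abs_nonneg _).trans (hf1 (1 / 2) (by norm_num) (by norm_num))
    linarith
  set b : ℝ → ℝ := fun t => C * (t ^ ((1 : ℝ) - 1) * (Iio (1 : ℝ)).indicator 1 t)
    + t ^ (δ₀ - 1) * f t
  have hb : IntegrableOn b (Ioi 0) :=
    ((integrableOn_rpow_indicator one_pos).1.const_mul C).add (hint δ₀ hδ₀ le_rfl)
  have hle : ∀ δ, 0 ≤ δ → δ ≤ δ₀ → ∀ t, 0 < t →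
      |t ^ δ * regularized f t| ≤ b t := by
    intro δ hδ hδ' t ht
    have h0 := hf0 t ht
    simp only [b, regularized, sub_self, Real.rpow_zero]
    by_cases h : t < 1
    · rw [indicator_of_mem (by exact h)]
      have h1 : t ^ δ ≤ 1 := Real.rpow_le_one ht.le h.le hδ
      have h2 : t⁻¹ * |f t - 1| ≤ C := by
        rw [inv_mul_le_iff₀ ht]; linarith [hf1 t ht h]
      have h3 : 0 ≤ t ^ (δ₀ - 1) * f t := by positivity
      simp only [Pi.one_apply, mul_one]
      rw [abs_mul, abs_mul, abs_of_pos (Real.rpow_pos_of_pos ht δ), abs_of_pos (inv_pos.2 ht)]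
      calc _ ≤ 1 * C := by gcongr
        _ ≤ _ := by linarith
    · rw [indicator_of_notMem (by exact h), sub_zero, mul_zero, mul_zero, zero_add,
        abs_of_nonneg (by positivity), ← mul_assoc]
      gcongr
      rw [Real.rpow_sub_one ht.ne', div_eq_mul_inv]
      gcongr
      exact not_lt.1 h
  have hm := measurable_regularized hf
  refine ⟨hb.mono' hm.aestronglyMeasurable (ae_restrict_of_forall_mem measurableSet_Ioi
    fun t ht => by simpa using hle 0 le_rfl hδ₀.le t ht), ?_⟩
  have hT : Tendsto (fun δ : ℝ => ∫ t in Ioi (0 : ℝ), t ^ δ * regularized f t) (𝓝[>] 0)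
      (𝓝 (∫ t in Ioi (0 : ℝ), regularized f t)) := by
    refine tendsto_integral_filter_of_dominated_convergence b ?_ ?_ hb ?_
    · exact Eventually.of_forall fun δ =>
        ((measurable_id.pow_const δ).mul hm).aestronglyMeasurable
    · filter_upwards [Ioo_mem_nhdsGT hδ₀] with δ hδ
      exact ae_restrict_of_forall_mem measurableSet_Ioi fun t ht => hle δ hδ.1.le hδ.2.le t ht
    · refine ae_restrict_of_forall_mem measurableSet_Ioi fun t (ht : 0 < t) => ?_
      have : Tendsto (fun δ : ℝ => t ^ δ * regularized f t) (𝓝 0)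
          (𝓝 (t ^ (0 : ℝ) * regularized f t)) :=
        ((Real.continuous_const_rpow ht.ne').tendsto 0).mul_const _
      rw [Real.rpow_zero, one_mul] at this
      exact this.mono_left nhdsWithin_le_nhds
  refine hT.congr' ?_
  filter_upwards [Ioo_mem_nhdsGT hδ₀] with δ hδ
  obtain ⟨h1, h2⟩ := integrableOn_rpow_indicator hδ.1
  rw [← h2, ← integral_sub (hint δ hδ.1 hδ.2.le) h1]
  refine setIntegral_congr_fun measurableSet_Ioi fun t (ht : 0 < t) => ?_
  simp only [regularized]
  rw [Real.rpow_sub_one ht.ne']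
  ring

/-- Here Γ(δ) - 1/δ = (Γ(1+δ) - Γ(1))/δ, which tends to Γ'(1). -/
theorem integrableOn_and_integral_regularized_exp :
    IntegrableOn (regularized fun u => Real.exp (-u)) (Ioi 0) ∧
    ∫ u in Ioi (0 : ℝ), regularized (fun u => Real.exp (-u)) u
      = -Real.eulerMascheroniConstant := by
  obtain ⟨h1, h2⟩ := integrableOn_and_tendsto_regularized (f := fun u => Real.exp (-u)) (C := 1)
    (δ₀ := 1) (by fun_prop) one_pos (fun t _ => (Real.exp_pos _).le) (fun t ht _ => by
      have h3 : Real.exp (-t) ≤ 1 := Real.exp_le_one_iff.2 (by linarith)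
      have h4 := Real.add_one_le_exp (-t)
      rw [abs_le]
      constructor <;> linarith) (fun δ hδ _ =>
        (Real.GammaIntegral_convergent hδ).congr_fun (fun t _ => mul_comm _ _) measurableSet_Ioi)
  refine ⟨h1, tendsto_nhds_unique h2 ?_⟩
  have h3 := (hasDerivAt_iff_tendsto_slope_zero.1 Real.hasDerivAt_Gamma_one).mono_left
    (nhdsWithin_mono 0 fun x (hx : 0 < x) => hx.ne')
  refine h3.congr' ?_
  filter_upwards [self_mem_nhdsWithin] with δ (hδ : 0 < δ)
  have h4 : ∫ t in Ioi (0 : ℝ), t ^ (δ - 1) * Real.exp (-t) = Real.Gamma δ := by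
    rw [Real.Gamma_eq_integral hδ]
    exact setIntegral_congr_fun measurableSet_Ioi fun t _ => mul_comm _ _
  rw [h4, Real.Gamma_one, add_comm, Real.Gamma_add_one hδ.ne', smul_eq_mul]
  field_simp

/-- The Mellin transform is a beta value, and after removal of 1/δ it is the difference quotient at
0 of Γ(1+x) Γ(A-x)/Γ(A). -/
theorem integrableOn_and_integral_regularized_rpow {A : ℝ} (hA : 0 < A) :
    IntegrableOn (regularized fun t => (1 + t) ^ (-A)) (Ioi 0) ∧
    ∫ t in Ioi (0 : ℝ), regularized (fun t => (1 + t) ^ (-A)) t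
      = -Real.eulerMascheroniConstant - psi A := by
  obtain ⟨h1, h2⟩ := integrableOn_and_tendsto_regularized (f := fun t => (1 + t) ^ (-A)) (C := A)
    (δ₀ := A / 2) (by fun_prop) (by linarith) (fun t ht => by positivity) (fun t ht _ => by
      have h3 : (1 + t) ^ (-A) ≤ 1 := Real.rpow_le_one_of_one_le_of_nonpos (by linarith) (by linarith)
      have h4 : 1 - A * t ≤ (1 + t) ^ (-A) := by
        rw [Real.rpow_def_of_pos (by linarith)]
        have h5 : Real.log (1 + t) ≤ t := by
          linarith [Real.log_le_sub_one_of_pos (by linarith : 0 < 1 + t)]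
        have h6 := Real.add_one_le_exp (Real.log (1 + t) * -A)
        nlinarith
      rw [abs_le]
      constructor <;> linarith [mul_pos hA ht]) (fun δ hδ hδ' =>
        (integrableOn_and_integral_beta_Ioi hδ (by linarith)).1)
  refine ⟨h1, tendsto_nhds_unique h2 ?_⟩
  have hGA : Real.Gamma A ≠ 0 := (Real.Gamma_pos_of_pos hA).ne'
  have hd1 : HasDerivAt (fun x : ℝ => Real.Gamma (1 + x)) (-Real.eulerMascheroniConstant) 0 := by
    have := Real.hasDerivAt_Gamma_one
    rw [← add_zero (1 : ℝ)] at this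
    exact this.comp_const_add 1 0
  have hd2 : HasDerivAt (fun x : ℝ => Real.Gamma (A - x)) (-deriv Real.Gamma A) 0 := by
    have hd : DifferentiableAt ℝ Real.Gamma A := Real.differentiableAt_Gamma fun m h => by
      have : (0 : ℝ) ≤ m := m.cast_nonneg
      linarith
    have := hd.hasDerivAt
    rw [← sub_zero A] at this
    simpa using this.comp_const_sub A 0
  have hd3 := (hd1.mul hd2).div_const (Real.Gamma A)
  have h3 := (hasDerivAt_iff_tendsto_slope_zero.1 hd3).mono_left
    (nhdsWithin_mono 0 fun x (hx : 0 < x) => hx.ne')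
  simp only [Pi.mul_apply, zero_add, add_zero, sub_zero, Real.Gamma_one, one_mul] at h3
  have h5 : (-Real.eulerMascheroniConstant * Real.Gamma A + -deriv Real.Gamma A) / Real.Gamma A
      = -Real.eulerMascheroniConstant - psi A := by
    rw [psi]; field_simp; ring
  rw [h5] at h3
  refine h3.congr' ?_
  filter_upwards [Ioo_mem_nhdsGT hA] with δ hδ
  rw [(integrableOn_and_integral_beta_Ioi hδ.1 hδ.2).2, add_comm 1 δ, Real.Gamma_add_one hδ.1.ne',
    smul_eq_mul, div_self hGA]
  have := hδ.1.ne'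
  field_simp

/-- `∫_{u > k} u⁻¹ e⁻ᵘ du + log k` for `k < 1`. -/
theorem integral_exp_indicator {k : ℝ} (hk : 0 < k) (hk1 : k < 1) :
    ∫ u in Ioi (0 : ℝ), (Ioi k).indicator (fun u => u⁻¹ * Real.exp (-u)) u
      = (∫ u in Ioi (0 : ℝ), (Ioi k).indicator (regularized fun u => Real.exp (-u)) u)
        - Real.log k := by
  have h1 : IntegrableOn ((Ioi k).indicator (regularized fun u => Real.exp (-u))) (Ioi 0) :=
    integrableOn_and_integral_regularized_exp.1.indicator measurableSet_Ioi
  have hI : IntegrableOn (fun u : ℝ => u⁻¹) (Ioo k 1) := by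
    refine (ContinuousOn.integrableOn_Icc fun x hx => ?_).mono_set Ioo_subset_Icc_self
    exact (continuousAt_inv₀ (lt_of_lt_of_le hk hx.1).ne').continuousWithinAt
  have hs : Ioo k 1 ∩ Ioi 0 = Ioo k 1 := by
    refine inter_eq_left.2 fun x hx => hk.trans hx.1
  have h2 : IntegrableOn ((Ioo k 1).indicator fun u : ℝ => u⁻¹) (Ioi 0) := by
    rw [integrableOn_indicator_iff measurableSet_Ioo, hs]
    exact hI
  have h3 : ∫ u in Ioi (0 : ℝ), (Ioo k 1).indicator (fun u : ℝ => u⁻¹) u = -Real.log k := by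
    rw [setIntegral_indicator measurableSet_Ioo, inter_comm, hs, ← integral_Ioc_eq_integral_Ioo,
      ← intervalIntegral.integral_of_le hk1.le, integral_inv_of_pos hk one_pos, one_div,
      Real.log_inv]
  rw [sub_eq_add_neg, ← h3, ← integral_add h1 h2]
  refine setIntegral_congr_fun measurableSet_Ioi fun u _ => ?_
  by_cases hu : k < u
  · by_cases hu1 : u < 1
    · simp [indicator, regularized, hu, hu1]; ring
    · simp [indicator, regularized, hu, hu1]
  · simp [indicator, hu]

/-- Substitute u = k t^{-1/2}: then dt/t becomes 2 du/u up to orientation, and t < 1 becomes u > k.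
-/
theorem integral_indicator_exp_rpow {k : ℝ} (hk : 0 < k) :
    ∫ t in Ioi (0 : ℝ), (Iio (1 : ℝ)).indicator
        (fun t => t⁻¹ * Real.exp (-k * t ^ (-(1 / 2) : ℝ))) t
      = 2 * ∫ u in Ioi (0 : ℝ), (Ioi k).indicator (fun u => u⁻¹ * Real.exp (-u)) u := by
  set g : ℝ → ℝ := (Iio (1 : ℝ)).indicator
    (fun t => t⁻¹ * Real.exp (-k * t ^ (-(1 / 2) : ℝ))) with hg
  have h1 := integral_comp_mul_left_Ioi' g 0 (pow_pos hk 2)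
  rw [mul_zero] at h1
  rw [← h1, ← integral_comp_rpow_Ioi (fun y => g (k ^ 2 * y)) (by norm_num : (-2 : ℝ) ≠ 0),
    smul_eq_mul, ← integral_const_mul, ← integral_const_mul]
  refine setIntegral_congr_fun measurableSet_Ioi fun u (hu : 0 < u) => ?_
  have h2 : u ^ (-2 : ℝ) = (u ^ 2)⁻¹ := by
    rw [Real.rpow_neg hu.le]; norm_cast
  have h3 : u ^ (-2 - 1 : ℝ) = (u ^ 3)⁻¹ := by
    rw [show (-2 - 1 : ℝ) = -3 by norm_num, Real.rpow_neg hu.le]; norm_cast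
  have h4 : (k ^ 2 * (u ^ 2)⁻¹) ^ (-(1 / 2) : ℝ) = u / k := by
    rw [show k ^ 2 * (u ^ 2)⁻¹ = (k / u) ^ 2 by field_simp, ← Real.rpow_natCast,
      ← Real.rpow_mul (by positivity)]
    norm_num [Real.rpow_neg_one]
  simp only [h2, h3, hg, smul_eq_mul, indicator]
  have h5 : k ^ 2 * (u ^ 2)⁻¹ ∈ Iio (1 : ℝ) ↔ u ∈ Ioi k := by
    rw [mem_Iio, mem_Ioi, ← div_eq_mul_inv, div_lt_one (by positivity)]
    exact pow_lt_pow_iff_left₀ hk.le hu.le two_ne_zero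
  by_cases hu2 : u ∈ Ioi k
  · rw [if_pos (h5.2 hu2), if_pos hu2, h4, show -k * (u / k) = -u by field_simp]
    norm_num
    field_simp
  · rw [if_neg (fun h => hu2 (h5.1 h)), if_neg hu2]
    simp

/-- Removing the indicator of t < 1 from (1+t)^{-A} leaves an integrable part with limit -γ - ψ(A).
The removed part is twice the integral of exp(-u)/u over u > k, that is -2 log k - 2γ + o(1). -/
theorem tendsto_pathwayIntegral_zero_add_log {A : ℝ} (hA : 0 < A) :
    Tendsto (fun k => pathwayIntegral 0 A k + 2 * Real.log k) (𝓝[>] 0)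
      (𝓝 (-3 * Real.eulerMascheroniConstant - psi A)) := by
  obtain ⟨hE1, hE2⟩ := integrableOn_and_integral_regularized_exp
  obtain ⟨hR1, hR2⟩ := integrableOn_and_integral_regularized_rpow hA
  set R := regularized fun t => (1 + t) ^ (-A) with hR
  set E := regularized fun u => Real.exp (-u) with hE
  have hexp : ∀ k t : ℝ, 0 < k → 0 < t → Real.exp (-k * t ^ (-(1 / 2) : ℝ)) ≤ 1 := by
    intro k t hk ht
    have : 0 ≤ k * t ^ (-(1 / 2) : ℝ) := by positivity
    exact Real.exp_le_one_iff.2 (by linarith)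
  have hRm : Measurable R := measurable_regularized (by fun_prop)
  have hEm : Measurable E := measurable_regularized (by fun_prop)
  have hRE : ∀ k, 0 < k →
      IntegrableOn (fun t => R t * Real.exp (-k * t ^ (-(1 / 2) : ℝ))) (Ioi 0) := by
    intro k hk
    refine hR1.norm.mono' (by fun_prop) ?_
    refine ae_restrict_of_forall_mem measurableSet_Ioi fun t ht => ?_
    rw [norm_mul, Real.norm_of_nonneg (Real.exp_pos _).le]
    exact mul_le_of_le_one_right (norm_nonneg _) (hexp k t hk ht)
  have hT1 : Tendsto (fun k => ∫ t in Ioi (0 : ℝ), R t * Real.exp (-k * t ^ (-(1 / 2) : ℝ)))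
      (𝓝[>] 0) (𝓝 (∫ t in Ioi (0 : ℝ), R t)) := by
    refine tendsto_integral_filter_of_dominated_convergence _ ?_ ?_ hR1.norm ?_
    · exact Eventually.of_forall fun k => by fun_prop
    · filter_upwards [self_mem_nhdsWithin] with k hk
      refine ae_restrict_of_forall_mem measurableSet_Ioi fun t ht => ?_
      rw [norm_mul, Real.norm_of_nonneg (Real.exp_pos _).le]
      exact mul_le_of_le_one_right (norm_nonneg _) (hexp k t hk ht)
    · refine ae_of_all _ fun t => ?_
      have : Continuous fun k : ℝ => R t * Real.exp (-k * t ^ (-(1 / 2) : ℝ)) := by fun_prop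
      have := this.tendsto 0
      simp only [neg_zero, zero_mul, Real.exp_zero, mul_one] at this
      exact this.mono_left nhdsWithin_le_nhds
  have hT2 : Tendsto (fun k => ∫ u in Ioi (0 : ℝ), (Ioi k).indicator E u)
      (𝓝[>] 0) (𝓝 (∫ u in Ioi (0 : ℝ), E u)) := by
    refine tendsto_integral_filter_of_dominated_convergence _ ?_ ?_ hE1.norm ?_
    · exact Eventually.of_forall fun k => (hEm.indicator measurableSet_Ioi).aestronglyMeasurable
    · exact Eventually.of_forall fun k => ae_of_all _ fun u => norm_indicator_le_norm_self _ _
    · refine ae_restrict_of_forall_mem measurableSet_Ioi fun u (hu : 0 < u) => ?_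
      refine tendsto_const_nhds.congr' ?_
      filter_upwards [Ioo_mem_nhdsGT hu] with k hk
      rw [indicator_of_mem (by exact hk.2)]
  have hT := hT1.add (hT2.const_mul 2)
  rw [hR2, hE2] at hT
  have hc : -Real.eulerMascheroniConstant - psi A + 2 * -Real.eulerMascheroniConstant
      = -3 * Real.eulerMascheroniConstant - psi A := by ring
  rw [hc] at hT
  refine hT.congr' ?_
  filter_upwards [Ioo_mem_nhdsGT (one_pos : (0 : ℝ) < 1)] with k hk
  have h1 := integral_indicator_exp_rpow hk.1
  rw [integral_exp_indicator hk.1 hk.2] at h1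
  have hs : pathwayIntegral 0 A k = (∫ t in Ioi (0 : ℝ), R t * Real.exp (-k * t ^ (-(1 / 2) : ℝ)))
      + ∫ t in Ioi (0 : ℝ), (Iio (1 : ℝ)).indicator
        (fun t => t⁻¹ * Real.exp (-k * t ^ (-(1 / 2) : ℝ))) t := by
    rw [pathwayIntegral, ← sub_eq_iff_eq_add',
      ← integral_sub (integrableOn_pathwayIntegrand hA hA hk.1) (hRE k hk.1)]
    refine setIntegral_congr_fun measurableSet_Ioi fun t (ht : 0 < t) => ?_
    simp only [pathwayIntegrand, hR, regularized, zero_sub, Real.rpow_neg_one, indicator, mem_Iio,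
      Pi.one_apply]
    split_ifs <;> ring
  rw [hs, h1]
  ring

/-! ### Exponential generating series with geometrically bounded coefficients -/

theorem summable_egf {a : ℕ → ℝ} {C B : ℝ} (ha : ∀ j, |a j| ≤ C * B ^ j) (k : ℝ) :
    Summable fun j => a j * (k ^ j / (j ! : ℝ)) := by
  refine ((Real.summable_pow_div_factorial (B * |k|)).mul_left C).of_norm_bounded fun j => ?_
  rw [Real.norm_eq_abs, abs_mul, abs_div, abs_pow, abs_of_pos (by positivity : (0 : ℝ) < j !)]
  calc |a j| * (|k| ^ j / j !) ≤ C * B ^ j * (|k| ^ j / j !) := by gcongr; exact ha j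
    _ = _ := by rw [mul_pow]; ring

theorem hasDerivAt_egf {a : ℕ → ℝ} {C B : ℝ} (hC : 0 ≤ C) (hB : 0 ≤ B)
    (ha : ∀ j, |a j| ≤ C * B ^ j) (k : ℝ) :
    HasDerivAt (fun k : ℝ => ∑' j, a j * (k ^ j / (j ! : ℝ)))
      (∑' j, a (j + 1) * (k ^ j / (j ! : ℝ))) k := by
  -- The constant term is split off, so that the derivative is a series in shifted coefficients.
  have h0 : (fun k : ℝ => ∑' j, a j * (k ^ j / (j ! : ℝ)))
      = fun k => a 0 + ∑' j, a (j + 1) * (k ^ (j + 1) / ((j + 1)! : ℝ)) := by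
    funext k
    rw [(summable_egf ha k).tsum_eq_zero_add]
    simp
  rw [h0]
  refine HasDerivAt.const_add _ ?_
  set R := |k| + 1
  have hk : k ∈ Ioo (-R) R := abs_lt.1 (lt_add_one _)
  refine hasDerivAt_tsum_of_isPreconnected
    (u := fun j => C * B * ((B * R) ^ j / (j ! : ℝ)))
    (g' := fun j k => a (j + 1) * (k ^ j / (j ! : ℝ)))
    ((Real.summable_pow_div_factorial (B * R)).mul_left (C * B)) isOpen_Ioo isPreconnected_Ioo
    (fun j y _ => ?_) (fun j y hy => ?_) hk ?_ hk
  · refine (((hasDerivAt_pow (j + 1) y).div_const ((j + 1)! : ℝ)).const_mul (a (j + 1))).congr_deriv ?_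
    rw [Nat.add_sub_cancel, Nat.factorial_succ]
    push_cast
    field_simp
  · have hy' : |y| ≤ R := (abs_lt.2 hy).le
    rw [Real.norm_eq_abs, abs_mul, abs_div, abs_pow, abs_of_pos (by positivity : (0 : ℝ) < j !)]
    calc |a (j + 1)| * (|y| ^ j / j !) ≤ C * B ^ (j + 1) * (R ^ j / j !) := by
          gcongr; exact ha (j + 1)
      _ = _ := by rw [mul_pow]; ring
  · exact (summable_nat_add_iff 1).2 (summable_egf ha k)

/-! ### The power series part -/

/-- The coefficients of the regular part; the gamma function vanishes at its poles. -/
noncomputable def regularCoeff (n : ℕ) (A : ℝ) (j : ℕ) : ℝ :=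
  (-1) ^ j * (Real.Gamma (((n : ℝ) - j) / 2) * Real.Gamma (A - ((n : ℝ) - j) / 2) / Real.Gamma A)

/-- The part of the expansion of the pathway integral that is a power series. -/
noncomputable def regularSeries (n : ℕ) (A k : ℝ) : ℝ :=
  ∑' j, regularCoeff n A j * (k ^ j / (j ! : ℝ))

theorem regularCoeff_succ_succ (n : ℕ) (A : ℝ) (j : ℕ) :
    regularCoeff (n + 1) A (j + 1) = -regularCoeff n A j := by
  unfold regularCoeff
  push_cast
  rw [add_sub_add_right_eq_sub, pow_succ]
  ring

/-- With x = (n-j)/2, the functional equation makes the ratio of coefficients (A-x)/(x-1) in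
absolute value. As x - 1 is a half-integer, it is 0 or at least 1/2 in size, which bounds the ratio
uniformly in j. -/
theorem abs_regularCoeff_add_two_le {n : ℕ} {A : ℝ} (hA : (n : ℝ) / 2 < A) (j : ℕ) :
    |regularCoeff n A (j + 2)| ≤ (2 * |A - 1| + 1) * |regularCoeff n A j| := by
  set x : ℝ := ((n : ℝ) - j) / 2 with hx
  have hj : (0 : ℝ) ≤ j := j.cast_nonneg
  have h1 : ((n : ℝ) - (j + 2 : ℕ)) / 2 = x - 1 := by rw [hx]; push_cast; ring
  have h2 : A - (x - 1) = A - x + 1 := by ring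
  have h3 : A - x ≠ 0 := by
    have : x ≤ n / 2 := by rw [hx]; linarith
    linarith
  unfold regularCoeff
  rw [h1, h2, Real.Gamma_add_one h3, ← hx]
  -- When x = 1 the next gamma argument is the pole 0, where the convention makes the coefficient
  -- vanish.
  by_cases h4 : x - 1 = 0
  · rw [h4, Real.Gamma_zero]
    simp only [zero_mul, zero_div, mul_zero, abs_zero]
    positivity
  have h5 : Real.Gamma x = (x - 1) * Real.Gamma (x - 1) := by
    rw [← Real.Gamma_add_one h4, sub_add_cancel]
  have h6 : 1 / 2 ≤ |x - 1| := by
    have h7 : x - 1 = (((n : ℤ) - j - 2 : ℤ) : ℝ) / 2 := by rw [hx]; push_cast; ring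
    have h8 : ((n : ℤ) - j - 2 : ℤ) ≠ 0 := fun h => h4 (by rw [h7, h]; simp)
    have h9 : (1 : ℝ) ≤ |(((n : ℤ) - j - 2 : ℤ) : ℝ)| := by
      rw [← Int.cast_abs]; exact_mod_cast Int.one_le_abs h8
    rw [h7, abs_div, abs_two]
    linarith
  have h10 : |A - x| ≤ (2 * |A - 1| + 1) * |x - 1| := by
    have : A - x = (A - 1) - (x - 1) := by ring
    rw [this]
    refine (abs_sub _ _).trans ?_
    nlinarith [abs_nonneg (A - 1)]
  rw [h5]
  simp only [abs_mul, abs_div, abs_pow, abs_neg, abs_one, one_pow, one_mul]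
  rw [← mul_div_assoc]
  refine div_le_div_of_nonneg_right ?_ (abs_nonneg _)
  calc |Real.Gamma (x - 1)| * (|A - x| * |Real.Gamma (A - x)|)
      ≤ |Real.Gamma (x - 1)| * ((2 * |A - 1| + 1) * |x - 1| * |Real.Gamma (A - x)|) := by gcongr
    _ = _ := by ring

theorem exists_abs_regularCoeff_le {n : ℕ} {A : ℝ} (hA : (n : ℝ) / 2 < A) :
    ∃ C B, 0 ≤ C ∧ 0 ≤ B ∧ ∀ j, |regularCoeff n A j| ≤ C * B ^ j := by
  set C := max |regularCoeff n A 0| |regularCoeff n A 1|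
  set B := 2 * |A - 1| + 1
  have hC : 0 ≤ C := (abs_nonneg _).trans (le_max_left _ _)
  have hB : 1 ≤ B := by have := abs_nonneg (A - 1); simp only [B]; linarith
  refine ⟨C, B, hC, by linarith, fun j => ?_⟩
  induction j using Nat.twoStepInduction with
  | zero => rw [pow_zero, mul_one]; exact le_max_left _ _
  | one => rw [pow_one]; exact (le_max_right _ _).trans (le_mul_of_one_le_right hC hB)
  | more j ih _ =>
    calc |regularCoeff n A (j + 2)| ≤ B * |regularCoeff n A j| := abs_regularCoeff_add_two_le hA j
      _ ≤ B * (C * B ^ j) := by gcongr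
      _ = C * B ^ (j + 1) := by ring
      _ ≤ C * B ^ (j + 2) := by gcongr; omega

theorem summable_regularSeries {n : ℕ} {A : ℝ} (hA : (n : ℝ) / 2 < A) (k : ℝ) :
    Summable fun j => regularCoeff n A j * (k ^ j / (j ! : ℝ)) := by
  obtain ⟨C, B, -, -, h⟩ := exists_abs_regularCoeff_le hA
  exact summable_egf h k

theorem differentiable_regularSeries {n : ℕ} {A : ℝ} (hA : (n : ℝ) / 2 < A) :
    Differentiable ℝ (regularSeries n A) := by
  obtain ⟨C, B, hC, hB, h⟩ := exists_abs_regularCoeff_le hA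
  exact fun k => (hasDerivAt_egf hC hB h k).differentiableAt

theorem hasDerivAt_regularSeries {n : ℕ} {A : ℝ} (hA : ((n + 1 : ℕ) : ℝ) / 2 < A) (k : ℝ) :
    HasDerivAt (regularSeries (n + 1) A) (-regularSeries n A k) k := by
  obtain ⟨C, B, hC, hB, h⟩ := exists_abs_regularCoeff_le hA
  refine (hasDerivAt_egf hC hB h k).congr_deriv ?_
  rw [regularSeries, ← tsum_neg]
  refine tsum_congr fun j => ?_
  rw [regularCoeff_succ_succ]
  ring

theorem regularSeries_at_zero (n : ℕ) (A : ℝ) :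
    regularSeries n A 0 = Real.Gamma ((n : ℝ) / 2) * Real.Gamma (A - (n : ℝ) / 2) / Real.Gamma A := by
  rw [regularSeries, tsum_eq_single 0]
  · simp [regularCoeff]
  · intro j hj
    simp [hj]

/-- With Γ = 0 at the poles, Γ(x+1) = xΓ(x) still holds for every x ≠ 0 and fails only at x = 0.
Hence the single defect 1/A at j = 0, which the logarithmic series cancels. -/
theorem regularCoeff_contiguous {A : ℝ} (hA : 0 < A) (j : ℕ) :
    regularCoeff 0 (A + 1) j - regularCoeff 0 A j + regularCoeff 2 (A + 1) j
      = if j = 0 then 1 / A else 0 := by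
  have hj : (0 : ℝ) ≤ j := j.cast_nonneg
  have hG : Real.Gamma A ≠ 0 := (Real.Gamma_pos_of_pos hA).ne'
  unfold regularCoeff
  split_ifs with h
  · subst h
    norm_num [Real.Gamma_zero, Real.Gamma_one, Real.Gamma_add_one hA.ne']
    field_simp
  · set x : ℝ := ((0 : ℕ) - (j : ℝ)) / 2 with hx
    have hj' : (0 : ℝ) < j := by positivity
    have hx0 : x < 0 := by rw [hx]; push_cast; linarith
    have h1 : ((2 : ℕ) - (j : ℝ)) / 2 = x + 1 := by rw [hx]; push_cast; ring
    have h2 : A + 1 - x = A - x + 1 := by ring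
    have h3 : A + 1 - (x + 1) = A - x := by ring
    rw [h1, h2, h3, Real.Gamma_add_one hx0.ne, Real.Gamma_add_one (by linarith),
      Real.Gamma_add_one hA.ne']
    field_simp
    ring

theorem regularSeries_contiguous {A k : ℝ} (hA : 0 < A) :
    regularSeries 0 (A + 1) k - regularSeries 0 A k + regularSeries 2 (A + 1) k = 1 / A := by
  have h1 := summable_regularSeries (n := 0) (A := A + 1) (by simp; linarith) k
  have h2 := summable_regularSeries (n := 0) (A := A) (by simpa) k
  have h3 := summable_regularSeries (n := 2) (A := A + 1) (by simpa) k
  unfold regularSeries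
  rw [← h1.tsum_sub h2, ← (h1.sub h2).tsum_add h3, tsum_eq_single 0]
  · have := regularCoeff_contiguous hA 0
    simpa using this
  · intro j hj
    have := regularCoeff_contiguous hA j
    rw [if_neg hj] at this
    rw [← sub_mul, ← add_mul, this, zero_mul]

/-- Again the functional equation, with its one failure at j = 0. The relation is the primitive of k
G_0' = -2A G_2(A+1), and serves because no G_{-1} is available. -/
theorem regularCoeff_mul {A : ℝ} (hA : 1 / 2 < A) (j : ℕ) :
    -regularCoeff 1 A (j + 1) + 2 * A * regularCoeff 3 (A + 1) (j + 1)
      - (j + 1) * regularCoeff 0 A j = if j = 0 then -2 else 0 := by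
  have hA0 : 0 < A := by linarith
  have hG : Real.Gamma A ≠ 0 := (Real.Gamma_pos_of_pos hA0).ne'
  unfold regularCoeff
  split_ifs with h
  · subst h
    norm_num [Real.Gamma_zero, Real.Gamma_one, Real.Gamma_add_one hA0.ne']
    field_simp
  · set x : ℝ := ((0 : ℕ) - (j : ℝ)) / 2 with hx
    have hj' : (0 : ℝ) < j := by positivity
    have hx0 : x < 0 := by rw [hx]; push_cast; linarith
    have h1 : ((3 : ℕ) - ((j + 1 : ℕ) : ℝ)) / 2 = x + 1 := by rw [hx]; push_cast; ring
    have h2 : ((1 : ℕ) - ((j + 1 : ℕ) : ℝ)) / 2 = x := by rw [hx]; push_cast; ring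
    have h3 : A + 1 - (x + 1) = A - x := by ring
    have h4 : (j : ℝ) = -2 * x := by rw [hx]; push_cast; ring
    rw [h1, h2, h3, h4, Real.Gamma_add_one hx0.ne, Real.Gamma_add_one hA0.ne', pow_succ]
    field_simp
    ring

theorem mul_regularSeries_zero {A k : ℝ} (hA : 1 / 2 < A) :
    k * regularSeries 0 A k = -regularSeries 1 A k + 2 * A * regularSeries 3 (A + 1) k + 2 * k := by
  have h1 := summable_regularSeries (n := 0) (A := A) (by simp; linarith) k
  have h2 := summable_regularSeries (n := 1) (A := A) (by simpa using hA) k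
  have h3 := summable_regularSeries (n := 3) (A := A + 1) (by norm_num; linarith) k
  have h4 : -regularSeries 1 A k + 2 * A * regularSeries 3 (A + 1) k - k * regularSeries 0 A k
      = -2 * k := by
    unfold regularSeries
    have h0 : -regularCoeff 1 A 0 + 2 * A * regularCoeff 3 (A + 1) 0 = 0 := by
      have hA0 : A ≠ 0 := by linarith
      have hG : Real.Gamma A ≠ 0 := (Real.Gamma_pos_of_pos (by linarith)).ne'
      have h5 : Real.Gamma (3 / 2) = 1 / 2 * Real.Gamma (1 / 2) := by
        rw [← Real.Gamma_add_one (by norm_num)]; norm_num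
      have h6 : A + 1 - 3 / 2 = A - 1 / 2 := by ring
      unfold regularCoeff
      simp only [Nat.cast_one, Nat.cast_ofNat, CharP.cast_eq_zero, sub_zero, pow_zero, one_mul]
      rw [h5, h6, Real.Gamma_add_one hA0]
      field_simp
      ring
    have h2' := (summable_nat_add_iff 1).2 h2
    have h3' := (summable_nat_add_iff 1).2 h3
    rw [h2.tsum_eq_zero_add, h3.tsum_eq_zero_add]
    have h7 : ∀ a b : ℝ, -(regularCoeff 1 A 0 * (k ^ 0 / (0 ! : ℝ)) + a)
        + 2 * A * (regularCoeff 3 (A + 1) 0 * (k ^ 0 / (0 ! : ℝ)) + b) = -a + 2 * A * b := by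
      intro a b
      simp only [pow_zero, Nat.factorial_zero, Nat.cast_one, div_one, mul_one]
      linear_combination h0
    rw [h7, ← tsum_neg, ← tsum_mul_left, ← tsum_mul_left, ← h2'.neg.tsum_add (h3'.mul_left _),
      ← (h2'.neg.add (h3'.mul_left _)).tsum_sub (h1.mul_left k)]
    have h8 : ∀ j : ℕ, -(regularCoeff 1 A (j + 1) * (k ^ (j + 1) / ((j + 1)! : ℝ)))
        + 2 * A * (regularCoeff 3 (A + 1) (j + 1) * (k ^ (j + 1) / ((j + 1)! : ℝ)))
        - k * (regularCoeff 0 A j * (k ^ j / (j ! : ℝ)))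
        = (if j = 0 then -2 else 0) * (k ^ (j + 1) / ((j + 1)! : ℝ)) := by
      intro j
      rw [← regularCoeff_mul hA j, Nat.factorial_succ]
      push_cast
      field_simp
      ring
    simp_rw [h8]
    rw [tsum_eq_single 0]
    · simp
    · intro j hj
      simp [hj]
  linarith

/-! ### The logarithmic part -/

theorem poch_succ (a : ℝ) (i : ℕ) : poch a (i + 1) = poch a i * (a + i) := by
  simp [poch, ascPochhammer_succ_eval]

theorem poch_zero (a : ℝ) : poch a 0 = 1 := by
  simp [poch]

theorem poch_succ_left (a : ℝ) (i : ℕ) : poch a (i + 1) = a * poch (a + 1) i := by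
  induction i with
  | zero => simp [poch_succ, poch_zero]
  | succ i ih =>
    rw [poch_succ, ih, poch_succ]
    push_cast
    ring

theorem poch_pos {a : ℝ} (ha : 0 < a) (i : ℕ) : 0 < poch a i :=
  ascPochhammer_pos i a ha

theorem poch_le {A : ℝ} (hA : 0 < A) (i : ℕ) : poch A i / (i ! : ℝ) ≤ (1 + A) ^ i := by
  induction i with
  | zero => simp [poch_zero]
  | succ i ih =>
    have hi : (0 : ℝ) ≤ i := i.cast_nonneg
    have h1 : poch A (i + 1) / ((i + 1)! : ℝ) = poch A i / (i ! : ℝ) * ((A + i) / (i + 1)) := by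
      rw [poch_succ, Nat.factorial_succ]; push_cast; field_simp
    have h2 : (A + i) / (i + 1) ≤ 1 + A := by
      rw [div_le_iff₀ (by positivity)]; nlinarith
    rw [h1, pow_succ]
    have := (poch_pos hA i).le
    gcongr

/-- The constant accompanying `-2 log k` in the `i`-th term of the logarithmic series. -/
noncomputable def psiConst (n : ℕ) (A : ℝ) (i : ℕ) : ℝ :=
  2 * psi (1 + (n + 2 * i : ℕ)) + psi (1 + (i : ℕ)) - psi (A + i)

/-- The increment is what makes the derivative of k^{N+1}/(N+1)! times the bracket equal to k^N/N!
times the preceding bracket, N = n + 2i. -/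
theorem psiConst_succ (n : ℕ) (A : ℝ) (i : ℕ) :
    psiConst (n + 1) A i = psiConst n A i + 2 / ((n + 2 * i : ℕ) + 1) := by
  have h := psi_add_one_of_pos (x := 1 + (n + 2 * i : ℕ)) (by positivity)
  unfold psiConst
  rw [show n + 1 + 2 * i = n + 2 * i + 1 by ring, Nat.cast_succ, ← add_assoc, h]
  ring

theorem exists_abs_psiConst_le (n : ℕ) {A : ℝ} (hA : 0 < A) :
    ∃ M, 0 ≤ M ∧ ∀ i, |psiConst n A i| ≤ M * 2 ^ i := by
  -- The psi bounds grow like (5 + 1/A) i, where 5 = 2·2 + 1, and i ≤ 2^i.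
  refine ⟨3 * |psi 1| + 2 * n + |psi A| + 5 + 1 / A, by positivity, fun i => ?_⟩
  have h1 := abs_psi_add_nat_le one_pos (n + 2 * i)
  have h2 := abs_psi_add_nat_le one_pos i
  have h3 := abs_psi_add_nat_le hA i
  rw [div_one] at h1 h2
  push_cast at h1
  have h4 : (i : ℝ) ≤ 2 ^ i := by exact_mod_cast Nat.lt_two_pow_self.le
  have h5 : (1 : ℝ) ≤ 2 ^ i := one_le_pow₀ (by norm_num)
  have h6 : (i : ℝ) / A ≤ 1 / A * 2 ^ i := by
    rw [div_mul_eq_mul_div, one_mul]; gcongr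
  have h7 : |psiConst n A i| ≤ 2 * |psi (1 + (n + 2 * i : ℕ))| + |psi (1 + (i : ℕ))| + |psi (A + i)| := by
    unfold psiConst
    refine (abs_sub _ _).trans ?_
    refine add_le_add_left ((abs_add_le _ _).trans ?_) _
    rw [abs_mul, abs_two]
  have h8 : 0 ≤ (3 * |psi 1| + 2 * n + |psi A|) * (2 ^ i - 1) :=
    mul_nonneg (by positivity) (by linarith)
  push_cast at h7
  nlinarith

/-- The `i`-th term of the logarithmic series. -/
noncomputable def logSeriesTerm (n : ℕ) (A k : ℝ) (i : ℕ) : ℝ :=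
  (-1) ^ (n + i) * (poch A i / (i ! : ℝ)) * (k ^ (n + 2 * i) / ((n + 2 * i)! : ℝ))
    * (-2 * Real.log k + psiConst n A i)

/-- The logarithmic part of the expansion of the pathway integral. -/
noncomputable def logSeries (n : ℕ) (A k : ℝ) : ℝ := ∑' i, logSeriesTerm n A k i

/-- The logarithm is controlled only in the product k^N log k, so that one bound serves both on
compact intervals, with Λ bounding |log k|, and for k → 0+, with K = Λ = 1. -/
theorem abs_logSeriesTerm_le {n : ℕ} {A M K Λ k : ℝ} {i : ℕ} (hA : 0 < A) (hM0 : 0 ≤ M)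
    (hM : |psiConst n A i| ≤ M * 2 ^ i) (hK : 0 ≤ K) (hΛ : 0 ≤ Λ) (hk : |k| ≤ K)
    (hkl : |k ^ (n + 2 * i) * Real.log k| ≤ Λ * K ^ (n + 2 * i)) :
    |logSeriesTerm n A k i|
      ≤ K ^ n * (2 * Λ + M) * ((2 * (1 + A) * K ^ 2) ^ i / (i ! : ℝ)) := by
  have h1 : logSeriesTerm n A k i = (-1) ^ (n + i) * ((poch A i / (i ! : ℝ)) *
      ((-2 * (k ^ (n + 2 * i) * Real.log k) + k ^ (n + 2 * i) * psiConst n A i)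
        / ((n + 2 * i)! : ℝ))) := by
    unfold logSeriesTerm; ring
  have hp := (poch_pos hA i).le
  have hk' : |k ^ (n + 2 * i)| ≤ K ^ (n + 2 * i) := by rw [abs_pow]; gcongr
  have h5 : (1 : ℝ) ≤ 2 ^ i := one_le_pow₀ (by norm_num)
  have h2 : |-2 * (k ^ (n + 2 * i) * Real.log k) + k ^ (n + 2 * i) * psiConst n A i|
      ≤ (2 * Λ + M) * 2 ^ i * K ^ (n + 2 * i) := by
    refine (abs_add_le _ _).trans ?_
    rw [abs_mul, abs_neg, abs_two, abs_mul _ (psiConst n A i)]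
    have h3 : |k ^ (n + 2 * i)| * |psiConst n A i| ≤ K ^ (n + 2 * i) * (M * 2 ^ i) := by gcongr
    have h4 : 0 ≤ Λ * K ^ (n + 2 * i) * (2 ^ i - 1) :=
      mul_nonneg (by positivity) (by linarith)
    linarith
  have hfac : ((i ! : ℕ) : ℝ) ≤ ((n + 2 * i)! : ℕ) := by
    exact_mod_cast Nat.factorial_le (by omega)
  rw [h1, abs_mul, abs_pow, abs_neg, abs_one, one_pow, one_mul, abs_mul,
    abs_of_nonneg (by positivity : 0 ≤ poch A i / (i ! : ℝ)), abs_div,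
    abs_of_pos (by positivity : (0 : ℝ) < (n + 2 * i)!)]
  calc _ ≤ (1 + A) ^ i * ((2 * Λ + M) * 2 ^ i * K ^ (n + 2 * i) / (i ! : ℝ)) := by
        gcongr
        exact poch_le hA i
    _ = _ := by rw [pow_add, pow_mul, mul_pow, mul_pow]; ring

theorem summable_logSeriesTerm {A k : ℝ} (n : ℕ) (hA : 0 < A) :
    Summable (logSeriesTerm n A k) := by
  obtain ⟨M, hM0, hM⟩ := exists_abs_psiConst_le n hA
  refine ((Real.summable_pow_div_factorial (2 * (1 + A) * |k| ^ 2)).mul_left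
    (|k| ^ n * (2 * |Real.log k| + M))).of_norm_bounded fun i => ?_
  refine abs_logSeriesTerm_le hA hM0 (hM i) (abs_nonneg k) (abs_nonneg _) le_rfl ?_
  rw [abs_mul, abs_pow, mul_comm]

theorem hasDerivAt_logSeriesTerm (n : ℕ) (A : ℝ) (i : ℕ) {k : ℝ} (hk : 0 < k) :
    HasDerivAt (fun k => logSeriesTerm (n + 1) A k i) (-logSeriesTerm n A k i) k := by
  unfold logSeriesTerm
  rw [psiConst_succ]
  have h1 : HasDerivAt (fun k : ℝ => k ^ (n + 1 + 2 * i) / ((n + 1 + 2 * i)! : ℝ))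
      (k ^ (n + 2 * i) / ((n + 2 * i)! : ℝ)) k := by
    rw [show n + 1 + 2 * i = n + 2 * i + 1 by ring]
    refine ((hasDerivAt_pow (n + 2 * i + 1) k).div_const _).congr_deriv ?_
    rw [Nat.add_sub_cancel, Nat.factorial_succ]
    push_cast
    field_simp
  have h2 := ((Real.hasDerivAt_log hk.ne').const_mul (-2)).add_const
    (psiConst n A i + 2 / ((n + 2 * i : ℕ) + 1))
  refine ((h1.const_mul ((-1) ^ (n + 1 + i) * (poch A i / (i ! : ℝ)))).mul h2).congr_deriv ?_
  rw [show n + 1 + 2 * i = n + 2 * i + 1 by ring, show n + 1 + i = n + i + 1 by ring,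
    Nat.factorial_succ]
  push_cast
  field_simp
  ring

theorem hasDerivAt_logSeries {A k : ℝ} (n : ℕ) (hA : 0 < A) (hk : 0 < k) :
    HasDerivAt (logSeries (n + 1) A) (-logSeries n A k) k := by
  obtain ⟨M, hM0, hM⟩ := exists_abs_psiConst_le n hA
  set K := 2 * k
  set Λ := max |Real.log (k / 2)| |Real.log K|
  have hΛ : 0 ≤ Λ := (abs_nonneg _).trans (le_max_left _ _)
  have hmem : k ∈ Ioo (k / 2) K := ⟨by linarith, by simp only [K]; linarith⟩
  unfold logSeries
  rw [← tsum_neg]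
  refine hasDerivAt_tsum_of_isPreconnected (g' := fun i k => -logSeriesTerm n A k i)
    (u := fun i => K ^ n * (2 * Λ + M) * ((2 * (1 + A) * K ^ 2) ^ i / (i ! : ℝ)))
    ((Real.summable_pow_div_factorial _).mul_left _) isOpen_Ioo isPreconnected_Ioo
    (fun i y hy => hasDerivAt_logSeriesTerm n A i (by linarith [hy.1])) (fun i y hy => ?_) hmem
    (summable_logSeriesTerm (n + 1) hA) hmem
  have hy0 : 0 < y := by linarith [hy.1]
  rw [norm_neg]
  refine abs_logSeriesTerm_le hA hM0 (hM i) (by simp only [K]; linarith) hΛ ?_ ?_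
  · rw [abs_of_pos hy0]; exact hy.2.le
  · rw [abs_mul, abs_pow, abs_of_pos hy0, mul_comm]
    have h1 : Real.log (k / 2) ≤ Real.log y := Real.log_le_log (by linarith) hy.1.le
    have h2 : Real.log y ≤ Real.log K := Real.log_le_log hy0 hy.2.le
    have h3 : |Real.log y| ≤ Λ := abs_le_max_abs_abs h1 h2
    gcongr
    exact hy.2.le

theorem tendsto_logSeriesTerm_zero {n i : ℕ} (A : ℝ) (h : n + 2 * i ≠ 0) :
    Tendsto (fun k => logSeriesTerm n A k i) (𝓝[>] 0) (𝓝 0) := by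
  obtain ⟨N, hN⟩ := Nat.exists_eq_succ_of_ne_zero h
  -- One factor k is kept beside log k, because k log k is continuous at 0.
  have h1 : Continuous fun k : ℝ => (-1) ^ (n + i) * (poch A i / (i ! : ℝ)) * (1 / ((n + 2 * i)! : ℝ))
    * (-2 * (k ^ N * (k * Real.log k)) + k ^ (n + 2 * i) * psiConst n A i) := by
    have := Real.continuous_mul_log
    fun_prop
  have h2 := h1.tendsto 0
  simp only [zero_mul, mul_zero, ne_eq, h, not_false_eq_true, zero_pow, add_zero] at h2
  refine (h2.mono_left nhdsWithin_le_nhds).congr fun k => ?_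
  unfold logSeriesTerm
  rw [hN, Nat.succ_eq_add_one, pow_succ k]
  ring

theorem abs_pow_mul_log_le {N : ℕ} (hN : N ≠ 0) {k : ℝ} (hk : 0 < k) (hk1 : k ≤ 1) :
    |k ^ N * Real.log k| ≤ 1 := by
  obtain ⟨N, rfl⟩ := Nat.exists_eq_succ_of_ne_zero hN
  have h1 := (Real.abs_log_mul_self_lt k hk hk1).le
  rw [pow_succ, mul_assoc, mul_comm k, abs_mul]
  refine mul_le_one₀ ?_ (abs_nonneg _) h1
  rw [abs_pow, abs_of_pos hk]
  exact pow_le_one₀ hk.le hk1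

theorem tendsto_logSeries_zero {n : ℕ} {A : ℝ} (hn : n ≠ 0) (hA : 0 < A) :
    Tendsto (logSeries n A) (𝓝[>] 0) (𝓝 0) := by
  obtain ⟨M, hM0, hM⟩ := exists_abs_psiConst_le n hA
  have := tendsto_tsum_of_dominated_convergence (𝓕 := 𝓝[>] (0 : ℝ))
    (f := fun k => logSeriesTerm n A k) (g := fun _ => 0)
    (bound := fun i => 1 ^ n * (2 * 1 + M) * ((2 * (1 + A) * 1 ^ 2) ^ i / (i ! : ℝ)))
    ((Real.summable_pow_div_factorial _).mul_left _)
    (fun i => tendsto_logSeriesTerm_zero A (by omega)) ?_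
  · rwa [tsum_zero] at this
  · filter_upwards [Ioo_mem_nhdsGT (one_pos : (0 : ℝ) < 1)] with k hk i
    refine abs_logSeriesTerm_le hA hM0 (hM i) zero_le_one zero_le_one ?_ ?_
    · rw [abs_of_pos hk.1]; exact hk.2.le
    · rw [one_pow, one_mul]
      exact abs_pow_mul_log_le (by omega) hk.1 hk.2.le

/-- Only the term i = 0 survives, with constant 2ψ(1) + ψ(1) - ψ(A) = -3γ - ψ(A). -/
theorem tendsto_logSeries_zero_add_log {A : ℝ} (hA : 0 < A) :
    Tendsto (fun k => logSeries 0 A k + 2 * Real.log k) (𝓝[>] 0)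
      (𝓝 (-3 * Real.eulerMascheroniConstant - psi A)) := by
  obtain ⟨M, hM0, hM⟩ := exists_abs_psiConst_le 0 hA
  have h1 := tendsto_tsum_of_dominated_convergence (𝓕 := 𝓝[>] (0 : ℝ))
    (f := fun k i => logSeriesTerm 0 A k (i + 1)) (g := fun _ => 0)
    (bound := fun i => 1 ^ 0 * (2 * 1 + M) * ((2 * (1 + A) * 1 ^ 2) ^ (i + 1) / ((i + 1)! : ℝ)))
    (((summable_nat_add_iff 1).2 (Real.summable_pow_div_factorial _)).mul_left _)
    (fun i => tendsto_logSeriesTerm_zero A (by omega)) ?_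
  · rw [tsum_zero] at h1
    have h2 := h1.add_const (-3 * Real.eulerMascheroniConstant - psi A)
    rw [zero_add] at h2
    refine h2.congr fun k => ?_
    rw [logSeries, (summable_logSeriesTerm 0 hA).tsum_eq_zero_add]
    simp only [logSeriesTerm, psiConst, poch_zero, Nat.factorial_zero, Nat.cast_one, div_one,
      mul_zero, add_zero, pow_zero, mul_one, one_mul, Nat.cast_zero, psi_one]
    ring
  · filter_upwards [Ioo_mem_nhdsGT (one_pos : (0 : ℝ) < 1)] with k hk i
    refine abs_logSeriesTerm_le hA hM0 (hM _) zero_le_one zero_le_one ?_ ?_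
    · rw [abs_of_pos hk.1]; exact hk.2.le
    · rw [one_pow, one_mul]
      exact abs_pow_mul_log_le (by omega) hk.1 hk.2.le

theorem psiConst_add_one_succ_index {A : ℝ} (hA : 0 < A) (n i : ℕ) :
    psiConst n (A + 1) (i + 1) = psiConst (n + 2) (A + 1) i + 1 / (i + 1) - 1 / (A + 1 + i) := by
  have h1 := psi_add_one_of_pos (x := 1 + (i : ℝ)) (by positivity)
  have h2 := psi_add_one_of_pos (x := A + 1 + i) (by positivity)
  unfold psiConst
  rw [show n + 2 * (i + 1) = n + 2 + 2 * i by ring, Nat.cast_succ i, ← add_assoc, h1, ← add_assoc (A + 1), h2]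
  ring

theorem psiConst_succ_index (A : ℝ) (n i : ℕ) :
    psiConst n A (i + 1) = psiConst (n + 2) (A + 1) i + 1 / (i + 1) := by
  have h1 := psi_add_one_of_pos (x := 1 + (i : ℝ)) (by positivity)
  unfold psiConst
  rw [show n + 2 * (i + 1) = n + 2 + 2 * i by ring, Nat.cast_succ i, ← add_assoc, h1,
    add_right_comm A 1, add_assoc A]
  ring

/-- Terms i+1 of the difference cancel against terms i of the third series. What remains is i = 0,
where ψ(A+1) - ψ(A) = 1/A yields the opposite of the defect of the power series. -/
theorem logSeries_contiguous {A k : ℝ} (hA : 0 < A) :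
    logSeries 0 (A + 1) k - logSeries 0 A k + logSeries 2 (A + 1) k = -(1 / A) := by
  have hA1 : 0 < A + 1 := by linarith
  have h1 := summable_logSeriesTerm (k := k) 0 hA1
  have h2 := summable_logSeriesTerm (k := k) 0 hA
  have h3 := summable_logSeriesTerm (k := k) 2 hA1
  have h4 : ∀ i, logSeriesTerm 0 (A + 1) k (i + 1) - logSeriesTerm 0 A k (i + 1)
      = -logSeriesTerm 2 (A + 1) k i := by
    intro i
    unfold logSeriesTerm
    rw [psiConst_add_one_succ_index hA, psiConst_succ_index, poch_succ_left A, poch_succ (A + 1),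
      show 0 + 2 * (i + 1) = 2 + 2 * i by ring, Nat.factorial_succ i]
    have hi : (A + 1 + i) ≠ 0 := by positivity
    push_cast
    field_simp
    ring
  have h5 : logSeriesTerm 0 (A + 1) k 0 - logSeriesTerm 0 A k 0 = -(1 / A) := by
    simp only [logSeriesTerm, psiConst, poch_zero, Nat.factorial_zero, Nat.cast_one, div_one,
      mul_zero, add_zero, pow_zero, mul_one, one_mul, Nat.cast_zero, psi_add_one_of_pos hA]
    ring
  unfold logSeries
  rw [← h1.tsum_sub h2, (h1.sub h2).tsum_eq_zero_add, h5]
  simp_rw [h4]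
  rw [tsum_neg]
  ring

/-- Terms i+1 on the left match terms i of the series of index 3; the leftover at i = 0 cancels the
2k of the power series. -/
theorem mul_logSeries_zero {A k : ℝ} (hA : 0 < A) :
    k * logSeries 0 A k = -logSeries 1 A k + 2 * A * logSeries 3 (A + 1) k - 2 * k := by
  have h1 := (summable_logSeriesTerm (k := k) 0 hA).mul_left k
  have h2 := summable_logSeriesTerm (k := k) 1 hA
  have h3 := (summable_logSeriesTerm (k := k) 3 (by linarith : 0 < A + 1)).mul_left (2 * A)
  have h4 : ∀ i, k * logSeriesTerm 0 A k (i + 1) + logSeriesTerm 1 A k (i + 1)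
      = 2 * A * logSeriesTerm 3 (A + 1) k i := by
    intro i
    have h6 := psiConst_succ 0 A (i + 1)
    have h7 := psiConst_succ_index A 1 i
    have h8 : psiConst 0 A (i + 1) = psiConst 3 (A + 1) i + 1 / (i + 1)
        - 2 / ((0 + 2 * (i + 1) : ℕ) + 1) := by
      rw [← h7, h6]; ring
    unfold logSeriesTerm
    rw [h7, h8, poch_succ_left A, show 0 + 2 * (i + 1) = 2 * i + 2 by ring,
      show 1 + 2 * (i + 1) = 2 * i + 2 + 1 by ring, show 3 + 2 * i = 2 * i + 2 + 1 by ring,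
      Nat.factorial_succ i, Nat.factorial_succ (2 * i + 2)]
    push_cast
    field_simp
    ring
  have h5 : k * logSeriesTerm 0 A k 0 + logSeriesTerm 1 A k 0 = -2 * k := by
    simp only [logSeriesTerm, psiConst_succ 0 A 0]
    simp [poch_zero]
    ring
  unfold logSeries
  have h9 := (h1.add h2).tsum_eq_zero_add
  simp_rw [h4] at h9
  rw [h1.tsum_add h2, tsum_mul_left, tsum_mul_left, h5] at h9
  linarith

/-! ### The expansion of the pathway integral -/

/-- The convergent expansion of the pathway integral with exponent `n / 2 - 1`. -/
noncomputable def pathwayExpansion (n : ℕ) (A k : ℝ) : ℝ := regularSeries n A k + logSeries n A k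

theorem hasDerivAt_pathwayExpansion {n : ℕ} {A k : ℝ} (hA : ((n + 1 : ℕ) : ℝ) / 2 < A) (hk : 0 < k) :
    HasDerivAt (pathwayExpansion (n + 1) A) (-pathwayExpansion n A k) k := by
  have hA0 : 0 < A := lt_of_le_of_lt (by positivity) hA
  refine ((hasDerivAt_regularSeries hA k).add (hasDerivAt_logSeries n hA0 hk)).congr_deriv ?_
  rw [pathwayExpansion]
  ring

theorem tendsto_pathwayExpansion {n : ℕ} {A : ℝ} (hn : n ≠ 0) (hA : (n : ℝ) / 2 < A) :
    Tendsto (pathwayExpansion n A) (𝓝[>] 0)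
      (𝓝 (Real.Gamma ((n : ℝ) / 2) * Real.Gamma (A - (n : ℝ) / 2) / Real.Gamma A)) := by
  have hA0 : 0 < A := lt_of_le_of_lt (by positivity) hA
  have h := ((differentiable_regularSeries hA).continuous.tendsto 0).mono_left
    (nhdsWithin_le_nhds (s := Ioi 0))
  rw [regularSeries_at_zero] at h
  have h2 := h.add (tendsto_logSeries_zero hn hA0)
  rwa [add_zero] at h2

theorem tendsto_pathwayExpansion_zero_add_log {A : ℝ} (hA : 0 < A) :
    Tendsto (fun k => pathwayExpansion 0 A k + 2 * Real.log k) (𝓝[>] 0)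
      (𝓝 (-3 * Real.eulerMascheroniConstant - psi A)) := by
  have h := ((differentiable_regularSeries (n := 0) (A := A) (by simpa)).continuous.tendsto 0).mono_left
    (nhdsWithin_le_nhds (s := Ioi 0))
  rw [regularSeries_at_zero] at h
  simp only [CharP.cast_eq_zero, zero_div, Real.Gamma_zero, zero_mul] at h
  have h2 := h.add (tendsto_logSeries_zero_add_log hA)
  rw [zero_add] at h2
  refine h2.congr fun k => ?_
  rw [pathwayExpansion]
  ring

theorem pathwayExpansion_contiguous {A k : ℝ} (hA : 0 < A) :
    pathwayExpansion 0 (A + 1) k = pathwayExpansion 0 A k - pathwayExpansion 2 (A + 1) k := by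
  unfold pathwayExpansion
  linear_combination regularSeries_contiguous (k := k) hA + logSeries_contiguous (k := k) hA

/-- Adding the two product relations cancels ±2k and gives k G_0 = -G_1 + 2A G_3(A+1). Dividing by k
and differentiating yields the series counterpart of the integration by parts. -/
theorem hasDerivAt_pathwayExpansion_zero {A k : ℝ} (hA : 1 / 2 < A) (hk : 0 < k) :
    HasDerivAt (pathwayExpansion 0 A) (-(2 * A) * pathwayExpansion 2 (A + 1) k / k) k := by
  have hmul : ∀ x, x * pathwayExpansion 0 A x
      = -pathwayExpansion 1 A x + 2 * A * pathwayExpansion 3 (A + 1) x := by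
    intro x
    unfold pathwayExpansion
    linear_combination mul_regularSeries_zero (k := x) hA
      + mul_logSeries_zero (k := x) (by linarith : 0 < A)
  have h1 := hasDerivAt_pathwayExpansion (n := 0) (A := A) (by simpa using hA) hk
  have h3 := hasDerivAt_pathwayExpansion (n := 2) (A := A + 1) (by norm_num; linarith) hk
  have h := (h1.neg.add (h3.const_mul (2 * A))).div (hasDerivAt_id k) hk.ne'
  have he : pathwayExpansion 0 A =ᶠ[𝓝 k]
      fun x => (-pathwayExpansion 1 A x + 2 * A * pathwayExpansion 3 (A + 1) x) / x := by
    filter_upwards [Ioi_mem_nhds hk] with x (hx : 0 < x)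
    rw [← hmul, mul_div_cancel_left₀ _ hx.ne']
  refine (h.congr_of_eventuallyEq he).congr_deriv ?_
  have := hmul k
  simp only [id, Pi.add_apply, Pi.neg_apply]
  field_simp
  linear_combination this

/-- The differences between integrals and expansions solve the singular system with a = -2A. All
three tend to 0: the logarithms cancel in X, and the beta values cancel in Y and Z. -/
theorem pathwayIntegral_zero_eq {A k : ℝ} (hA : 1 / 2 < A) (hk : 0 < k) :
    pathwayIntegral 0 A k = pathwayExpansion 0 A k := by
  have hA0 : 0 < A := by linarith
  have hA1 : 0 < A + 1 := by linarith
  refine sub_eq_zero.1 (eq_zero_of_singular_system (a := -(2 * A))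
    (X := fun k => pathwayIntegral 0 A k - pathwayExpansion 0 A k)
    (Y := fun k => pathwayIntegral 1 (A + 1) k - pathwayExpansion 2 (A + 1) k)
    (Z := fun k => -(pathwayIntegral (1 / 2) (A + 1) k - pathwayExpansion 1 (A + 1) k))
    (fun k hk => ?_) (fun k hk => ?_) (fun k hk => ?_) ?_ ?_ ?_ hk)
  · refine ((hasDerivAt_pathwayIntegral hA0 hA0 hk).sub
      (hasDerivAt_pathwayExpansion_zero hA hk)).congr_deriv ?_
    have := mul_pathwayIntegral_neg_half hA0 hk
    rw [zero_sub]
    field_simp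
    linear_combination -this
  · refine ((hasDerivAt_pathwayIntegral hA1 (by linarith) hk).sub
      (hasDerivAt_pathwayExpansion (n := 1) (by norm_num; linarith) hk)).congr_deriv ?_
    norm_num
    ring
  · refine ((hasDerivAt_pathwayIntegral hA1 (by linarith) hk).sub
      (hasDerivAt_pathwayExpansion (n := 0) (by norm_num; linarith) hk)).neg.congr_deriv ?_
    have h1 := pathwayIntegral_zero_add_one hA0 hk
    have h2 := pathwayExpansion_contiguous (k := k) hA0
    rw [sub_self]
    linear_combination h1 - h2
  · have := (tendsto_pathwayIntegral_zero_add_log hA0).sub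
      (tendsto_pathwayExpansion_zero_add_log hA0)
    rw [sub_self] at this
    exact this.congr fun k => by ring
  · have h1 := tendsto_pathwayIntegral_zero one_pos (by linarith : 1 < A + 1)
    have h2 := tendsto_pathwayExpansion (n := 2) (A := A + 1) two_ne_zero (by norm_num; linarith)
    have := h1.sub h2
    norm_num at this
    exact this
  · have h1 := tendsto_pathwayIntegral_zero (p := 1 / 2) (by norm_num) (by linarith : 1 / 2 < A + 1)
    have h2 := tendsto_pathwayExpansion (n := 1) (A := A + 1) one_ne_zero (by norm_num; linarith)
    have := (h1.sub h2).neg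
    rw [Nat.cast_one, sub_self, neg_zero] at this
    exact this

theorem pathwayIntegral_eq {n : ℕ} {A k : ℝ} (hA : 1 / 2 < A) (hn : (n : ℝ) / 2 < A) (hk : 0 < k) :
    pathwayIntegral ((n : ℝ) / 2) A k = pathwayExpansion n A k := by
  induction n generalizing k with
  | zero => simpa using pathwayIntegral_zero_eq hA hk
  | succ n ih =>
    have hA0 : 0 < A := by linarith
    have hn' : (n : ℝ) / 2 < A := by push_cast at hn; linarith
    have hp : ((n + 1 : ℕ) : ℝ) / 2 - 1 / 2 = n / 2 := by push_cast; ring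
    have hd : ∀ k, 0 < k → HasDerivAt (fun k => pathwayIntegral (((n + 1 : ℕ) : ℝ) / 2) A k
        - pathwayExpansion (n + 1) A k) 0 k := by
      intro k hk
      refine ((hasDerivAt_pathwayIntegral hA0 hn hk).sub
        (hasDerivAt_pathwayExpansion hn hk)).congr_deriv ?_
      rw [hp, ih hn' hk, sub_self]
    have h0 : Tendsto (fun k => pathwayIntegral (((n + 1 : ℕ) : ℝ) / 2) A k
        - pathwayExpansion (n + 1) A k) (𝓝[>] 0) (𝓝 0) := by
      have := (tendsto_pathwayIntegral_zero (by positivity) hn).sub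
        (tendsto_pathwayExpansion n.succ_ne_zero hn)
      rwa [sub_self] at this
    -- A zero derivative and a zero limit at the origin: the comparison with c = 0 gives the value
    -- 0.
    have := abs_le_pow_of_hasDerivAt (K := k) (c := 0) (p := 0) hd (by simp) h0 hk le_rfl
    rw [zero_mul] at this
    exact sub_eq_zero.1 (abs_nonpos_iff.1 this)

/-! ### Gamma functions, factorials and Pochhammer symbols -/

theorem Gamma_add_nat_eq_poch {x : ℝ} (hx : 0 < x) (r : ℕ) :
    Real.Gamma (x + r) = poch x r * Real.Gamma x := by
  induction r with
  | zero => simp [poch_zero]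
  | succ r ih =>
    push_cast
    rw [← add_assoc, Real.Gamma_add_one (by positivity), ih, poch_succ]
    ring

/-- The functional equation iterated downwards; the hypothesis keeps the arguments x-1, ..., x-r
away from 0. -/
theorem Gamma_eq_poch_mul_Gamma_sub_nat {x : ℝ} {r : ℕ} (hx : ∀ i < r, x - 1 - i ≠ 0) :
    Real.Gamma x = (-1) ^ r * poch (1 - x) r * Real.Gamma (x - r) := by
  induction r with
  | zero => simp [poch_zero]
  | succ r ih =>
    have h1 : x - r = x - (r + 1 : ℕ) + 1 := by push_cast; ring
    have h2 : x - (r + 1 : ℕ) ≠ 0 := by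
      have := hx r (Nat.lt_succ_self r)
      push_cast
      rwa [add_comm, ← sub_sub]
    rw [ih fun i hi => hx i (hi.trans (Nat.lt_succ_self r)), h1, Real.Gamma_add_one h2, poch_succ,
      pow_succ]
    push_cast
    ring

theorem factorial_two_mul (r : ℕ) : ((2 * r)! : ℝ) = 4 ^ r * (r ! : ℝ) * poch (1 / 2) r := by
  induction r with
  | zero => simp [poch_zero]
  | succ r ih =>
    rw [show 2 * (r + 1) = 2 * r + 1 + 1 by ring, Nat.factorial_succ, Nat.factorial_succ,
      Nat.factorial_succ, poch_succ]
    push_cast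
    rw [ih]
    ring

theorem factorial_two_mul_add_one (r : ℕ) :
    ((2 * r + 1)! : ℝ) = 4 ^ r * (r ! : ℝ) * poch (3 / 2) r := by
  induction r with
  | zero => simp [poch_zero]
  | succ r ih =>
    rw [show 2 * (r + 1) + 1 = 2 * r + 1 + 1 + 1 by ring, Nat.factorial_succ (2 * r + 1 + 1),
      Nat.factorial_succ (2 * r + 1), Nat.factorial_succ r, poch_succ]
    push_cast
    rw [ih]
    ring

theorem poch_add (a : ℝ) (m i : ℕ) : poch a (m + i) = poch a m * poch (a + m) i := by
  induction i with
  | zero => simp [poch_zero]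
  | succ i ih =>
    rw [← add_assoc, poch_succ, ih, poch_succ]
    push_cast
    ring

theorem half_sub_nat_ne_zero (N i : ℕ) : (N : ℝ) + 1 / 2 - i ≠ 0 := by
  intro h
  have h' : ((2 * N + 1 : ℕ) : ℝ) = ((2 * i : ℕ) : ℝ) := by push_cast; linarith
  have := Nat.cast_injective (R := ℝ) h'
  omega

theorem pi_rpow_neg_half_mul : Real.pi ^ (-(1 / 2) : ℝ) * Real.pi ^ ((1 : ℝ) / 2) = 1 := by
  rw [← Real.rpow_add Real.pi_pos]
  norm_num

theorem two_mul_sqrt_pow_even {z : ℝ} (hz : 0 < z) (r : ℕ) :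
    (2 * z ^ ((1 : ℝ) / 2)) ^ (2 * r) = 4 ^ r * z ^ r := by
  rw [pow_mul, mul_pow, ← Real.rpow_natCast (z ^ ((1 : ℝ) / 2)), ← Real.rpow_mul hz.le, mul_pow]
  norm_num

/-! ### Matching the three parts of the expansion -/

/-- For even j the argument of Γ is a half-integer, never a pole. Lowering Γ(3/2+m) by r gives the
parameter -1/2-m, and (2r)! = 4^r r! (1/2)_r gives the parameter 1/2. -/
theorem regularCoeff_even {A z : ℝ} {m : ℕ} (hA : (m : ℝ) + 3 / 2 < A) (hz : 0 < z) (r : ℕ) :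
    regularCoeff (2 * m + 3) A (2 * r) * ((2 * z ^ ((1 : ℝ) / 2)) ^ (2 * r) / ((2 * r)! : ℝ))
      = Real.Gamma (A - 3 / 2 - m) * Real.Gamma (3 / 2 + m) / Real.Gamma A
        * hyp1F2Term (A - 3 / 2 - m) (1 / 2) (-(1 / 2) - m) (-z) r := by
  have h1 : (((2 * m + 3 : ℕ) : ℝ) - (2 * r : ℕ)) / 2 = 3 / 2 + m - r := by push_cast; ring
  have h2 : A - (3 / 2 + m - r) = A - 3 / 2 - m + r := by ring
  have h3 := Gamma_eq_poch_mul_Gamma_sub_nat (x := 3 / 2 + m) (r := r) fun i _ => by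
    have := half_sub_nat_ne_zero m i
    rwa [show (3 / 2 + m - 1 - i : ℝ) = m + 1 / 2 - i by ring]
  have h4 : (0 : ℝ) < Real.Gamma (3 / 2 + m) := Real.Gamma_pos_of_pos (by positivity)
  rw [show (1 : ℝ) - (3 / 2 + m) = -(1 / 2) - m by ring] at h3
  -- A zero Pochhammer factor would force Γ(3/2+m) = 0.
  have h5 : poch (-(1 / 2) - m) r ≠ 0 := by
    intro h; rw [h] at h3; simp at h3; linarith
  have h6 := poch_pos (show (0 : ℝ) < 1 / 2 by norm_num) r
  rw [two_mul_sqrt_pow_even hz, factorial_two_mul, regularCoeff, h1, h2,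
    Gamma_add_nat_eq_poch (by linarith), h3, hyp1F2Term, neg_pow z, pow_mul, neg_one_sq, one_pow]
  have h7 : ((-1 : ℝ) ^ r) * (-1) ^ r = 1 := by rw [← mul_pow]; norm_num
  have h8 : Real.Gamma A ≠ 0 := (Real.Gamma_pos_of_pos (by linarith [m.cast_nonneg (α := ℝ)])).ne'
  generalize poch (A - 3 / 2 - m) r = P
  generalize Real.Gamma (A - 3 / 2 - m) = G
  generalize Real.Gamma (3 / 2 + m - r) = G'
  generalize poch (-(1 / 2) - (m : ℝ)) r = Q at h5 ⊢
  generalize poch (1 / 2) r = R at h6 ⊢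
  generalize (-1 : ℝ) ^ r = s at h7 ⊢
  field_simp
  linear_combination -(G' * P * G) * h7

theorem regularCoeff_odd {A z : ℝ} {m r : ℕ} (hA : (m : ℝ) + 3 / 2 < A) (hz : 0 < z)
    (hr : r ≤ m) :
    regularCoeff (2 * m + 3) A (2 * r + 1)
        * ((2 * z ^ ((1 : ℝ) / 2)) ^ (2 * r + 1) / ((2 * r + 1)! : ℝ))
      = -(2 * Real.Gamma (A - 1 - m) * Real.Gamma (1 + m) / Real.Gamma A * z ^ ((1 : ℝ) / 2)
        * ((-1) ^ r / (r ! : ℝ) * (poch (A - 1 - m) r / (poch (3 / 2) r * poch (-(m : ℝ)) r))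
          * z ^ r)) := by
  have h1 : (((2 * m + 3 : ℕ) : ℝ) - (2 * r + 1 : ℕ)) / 2 = 1 + m - r := by push_cast; ring
  have h2 : A - (1 + m - r) = A - 1 - m + r := by ring
  have h3 := Gamma_eq_poch_mul_Gamma_sub_nat (x := 1 + m) (r := r) fun i hi => by
    have : (i : ℝ) < m := by exact_mod_cast hi.trans_le hr
    linarith
  have h4 : (0 : ℝ) < Real.Gamma (1 + m) := Real.Gamma_pos_of_pos (by positivity)
  rw [show (1 : ℝ) - (1 + m) = -m by ring] at h3
  have h5 : poch (-(m : ℝ)) r ≠ 0 := by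
    intro h; rw [h] at h3; simp at h3; linarith
  have h6 := poch_pos (show (0 : ℝ) < 3 / 2 by norm_num) r
  rw [pow_succ, two_mul_sqrt_pow_even hz, factorial_two_mul_add_one, regularCoeff, h1, h2,
    Gamma_add_nat_eq_poch (by linarith), h3, pow_succ, pow_mul, neg_one_sq, one_pow]
  have h7 : ((-1 : ℝ) ^ r) * (-1) ^ r = 1 := by rw [← mul_pow]; norm_num
  have h8 : Real.Gamma A ≠ 0 := (Real.Gamma_pos_of_pos (by linarith [m.cast_nonneg (α := ℝ)])).ne'
  generalize poch (A - 1 - m) r = P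
  generalize Real.Gamma (A - 1 - m) = G
  generalize Real.Gamma (1 + m - r) = G'
  generalize poch (-(m : ℝ)) r = Q at h5 ⊢
  generalize poch (3 / 2) r = R at h6 ⊢
  generalize (-1 : ℝ) ^ r = s at h7 ⊢
  field_simp
  linear_combination (G' * P * G) * h7

/-- These are the pole indices j = 2m+3+2s, whose powers of k belong to the logarithmic series. -/
theorem regularCoeff_odd_eq_zero (A : ℝ) {m r : ℕ} (hr : m < r) :
    regularCoeff (2 * m + 3) A (2 * r + 1) = 0 := by
  obtain ⟨s, rfl⟩ := Nat.exists_eq_add_of_lt hr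
  have h1 : (((2 * m + 3 : ℕ) : ℝ) - (2 * (m + s + 1) + 1 : ℕ)) / 2 = -s := by push_cast; ring
  rw [regularCoeff, h1, Real.Gamma_neg_nat_eq_zero]
  simp

theorem summable_regularCoeff_even {A : ℝ} {m : ℕ} (hA : (m : ℝ) + 3 / 2 < A) (k : ℝ) :
    Summable fun r =>
      regularCoeff (2 * m + 3) A (2 * r) * (k ^ (2 * r) / ((2 * r)! : ℝ)) :=
  (summable_regularSeries (by push_cast; linarith) k).comp_injective (i := fun r => 2 * r)
    fun a b h => by simpa using h

theorem tsum_regularCoeff_even {A z : ℝ} {m : ℕ} (hA : (m : ℝ) + 3 / 2 < A) (hz : 0 < z) :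
    ∑' r, regularCoeff (2 * m + 3) A (2 * r)
        * ((2 * z ^ ((1 : ℝ) / 2)) ^ (2 * r) / ((2 * r)! : ℝ))
      = Real.Gamma (A - 3 / 2 - m) * Real.Gamma (3 / 2 + m) / Real.Gamma A
          * hyp1F2 (A - 3 / 2 - m) (1 / 2) (-(1 / 2) - m) (-z) := by
  rw [hyp1F2, ← tsum_mul_left]
  exact tsum_congr (regularCoeff_even hA hz)

theorem tsum_regularCoeff_odd {A z : ℝ} {m : ℕ} (hA : (m : ℝ) + 3 / 2 < A) (hz : 0 < z) :
    ∑' r, regularCoeff (2 * m + 3) A (2 * r + 1)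
        * ((2 * z ^ ((1 : ℝ) / 2)) ^ (2 * r + 1) / ((2 * r + 1)! : ℝ))
      = -(2 * Real.Gamma (A - 1 - m) * Real.Gamma (1 + m) / Real.Gamma A * z ^ ((1 : ℝ) / 2)
        * ∑ r ∈ Finset.range (m + 1), (-1) ^ r / (r ! : ℝ)
              * (poch (A - 1 - m) r / (poch (3 / 2) r * poch (-(m : ℝ)) r)) * z ^ r) := by
  rw [tsum_eq_sum (s := Finset.range (m + 1)), Finset.mul_sum, ← Finset.sum_neg_distrib]
  · refine Finset.sum_congr rfl fun r hr => ?_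
    exact regularCoeff_odd hA hz (Nat.lt_succ_iff.1 (Finset.mem_range.1 hr))
  · intro r hr
    rw [regularCoeff_odd_eq_zero A (by simpa using hr), zero_mul]

theorem summable_regularCoeff_odd {A : ℝ} {m : ℕ} (hA : (m : ℝ) + 3 / 2 < A) (k : ℝ) :
    Summable fun r =>
      regularCoeff (2 * m + 3) A (2 * r + 1) * (k ^ (2 * r + 1) / ((2 * r + 1)! : ℝ)) :=
  (summable_regularSeries (by push_cast; linarith) k).comp_injective (i := fun r => 2 * r + 1)
    fun a b h => by simpa using h

theorem regularSeries_eq_even_add_odd {A : ℝ} {m : ℕ} (hA : (m : ℝ) + 3 / 2 < A) (k : ℝ) :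
    regularSeries (2 * m + 3) A k
      = (∑' r, regularCoeff (2 * m + 3) A (2 * r) * (k ^ (2 * r) / ((2 * r)! : ℝ)))
        + ∑' r, regularCoeff (2 * m + 3) A (2 * r + 1)
            * (k ^ (2 * r + 1) / ((2 * r + 1)! : ℝ)) :=
  (tsum_even_add_odd (f := fun j => regularCoeff (2 * m + 3) A j * (k ^ j / (j ! : ℝ)))
    (summable_regularCoeff_even hA k) (summable_regularCoeff_odd hA k)).symm

/-- Duplication splits 2ψ(2m+4+2i) into ψ(m+2+i) + ψ(m+5/2+i) + 2 log 2. The last summand cancels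
the 2 log 2 coming from k = 2z^{1/2}, and reflection turns ψ(m+5/2+i) into ψ(-m-3/2-i). -/
theorem logSeriesTerm_eq (m : ℕ) {α b : ℝ} (hz : 0 < seriesVar α b) (hA : 0 < 1 / (α - 1)) (i : ℕ) :
    logSeriesTerm (2 * m + 3) (1 / (α - 1)) (2 * seriesVar α b ^ ((1 : ℝ) / 2)) i
      = Real.pi ^ (-(1 / 2) : ℝ) / Real.Gamma (1 / (α - 1)) * seriesVar α b ^ ((m : ℝ) + 3 / 2)
        * logTerm m α b i := by
  set A := 1 / (α - 1) with hAdef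
  set z := seriesVar α b with hzdef
  have hGA : Real.Gamma A ≠ 0 := (Real.Gamma_pos_of_pos hA).ne'
  have hlog : -2 * Real.log (2 * z ^ ((1 : ℝ) / 2)) + psiConst (2 * m + 3) A i
      = -Real.log z + coeffC m α i := by
    have h1 := psi_nat_duplication (m + 1 + i)
    have h2 := psi_half_sub_nat (m + 2 + i)
    rw [Real.log_mul two_ne_zero (by positivity), Real.log_rpow hz, psiConst, coeffC, ← hAdef]
    push_cast at h1 h2 ⊢
    rw [show (1 : ℝ) + (2 * m + 3 + 2 * i) = 2 * (m + 1 + i) + 2 by ring, h1,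
      show -(m : ℝ) - 3 / 2 - i = 1 / 2 - (m + 2 + i) by ring, h2,
      show (m : ℝ) + 1 + i + 3 / 2 = 1 / 2 + (m + 2 + i) by ring,
      show (m : ℝ) + 1 + i + 1 = 2 + m + i by ring]
    ring
  -- Descending from Γ(1/2) = π^{1/2} to Γ(-m-3/2) shows that π^{-1/2} Γ(-m-3/2) is rational, namely
  -- ±2/(3/2)_{m+1}.
  have hG := Gamma_eq_poch_mul_Gamma_sub_nat (x := 1 / 2) (r := m + 2) fun j _ => by
    have : (0 : ℝ) ≤ j := j.cast_nonneg
    linarith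
  rw [Real.Gamma_one_half_eq, Real.sqrt_eq_rpow, show (1 : ℝ) - 1 / 2 = 1 / 2 by norm_num,
    poch_succ_left, show (1 / 2 : ℝ) + 1 = 3 / 2 by norm_num,
    show (1 / 2 : ℝ) - (m + 2 : ℕ) = -m - 3 / 2 by push_cast; ring] at hG
  have hpi := pi_rpow_neg_half_mul
  rw [hG] at hpi
  have hpow : (2 * z ^ ((1 : ℝ) / 2)) ^ (2 * m + 3 + 2 * i)
      = 2 * 4 ^ (m + 1 + i) * (z ^ ((m : ℝ) + 3 / 2) * z ^ i) := by
    rw [show 2 * m + 3 + 2 * i = 2 * (m + 1 + i) + 1 by ring, pow_succ, two_mul_sqrt_pow_even hz,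
      show (m : ℝ) + 3 / 2 = ((m + 1 : ℕ) : ℝ) + 1 / 2 by push_cast; ring, Real.rpow_add hz,
      Real.rpow_natCast]
    ring
  have hfac : ((2 * m + 3 + 2 * i)! : ℝ)
      = 4 ^ (m + 1 + i) * ((1 + m + i)! : ℝ) * (poch (3 / 2) (m + 1) * poch (5 / 2 + m) i) := by
    rw [show 2 * m + 3 + 2 * i = 2 * (m + 1 + i) + 1 by ring, factorial_two_mul_add_one, poch_add,
      add_comm 1 m]
    push_cast
    rw [show (3 / 2 + ((m : ℝ) + 1)) = 5 / 2 + m by ring]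
  have hp1 := poch_pos (show (0 : ℝ) < 3 / 2 by norm_num) (m + 1)
  have hp2 := poch_pos (show (0 : ℝ) < 5 / 2 + m by positivity) i
  rw [logSeriesTerm, hlog, hpow, hfac, logTerm, coeffD, ← hAdef, ← hzdef]
  have hs : (-1 : ℝ) ^ (2 * m + 3 + i) = -(-1) ^ i := by
    rw [show 2 * m + 3 + i = 2 * (m + 1) + 1 + i by ring, pow_add, pow_succ, pow_mul]; norm_num
  have hs2 : (-1 : ℝ) ^ (1 + m + i) = -((-1) ^ (m + 2) * (-1) ^ i) := by
    rw [show 1 + m + i = 1 + (m + i) by ring, pow_add, pow_add, pow_add]; norm_num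
  rw [hs, hs2]
  have hD : Real.pi ^ (-(1 / 2) : ℝ) * (-1) ^ (m + 2) * Real.Gamma (-m - 3 / 2)
      = 2 / poch (3 / 2) (m + 1) := by
    rw [eq_div_iff hp1.ne']
    linear_combination 2 * hpi
  have h8 : Real.pi ^ (-(1 / 2) : ℝ) / Real.Gamma A * z ^ ((m : ℝ) + 3 / 2) *
      (z ^ i * (-Real.log z + coeffC m α i) * (-((-1) ^ (m + 2) * (-1) ^ i)
        * Real.Gamma (-m - 3 / 2) * Real.Gamma A * poch A i
          / (poch (5 / 2 + m) i * (i ! : ℝ) * ((1 + m + i)! : ℝ))))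
      = (Real.pi ^ (-(1 / 2) : ℝ) * (-1) ^ (m + 2) * Real.Gamma (-m - 3 / 2)) *
        (z ^ ((m : ℝ) + 3 / 2) * (z ^ i * (-Real.log z + coeffC m α i) * (-(-1) ^ i * poch A i
          / (poch (5 / 2 + m) i * (i ! : ℝ) * ((1 + m + i)! : ℝ))))) := by
    field_simp
  rw [h8, hD]
  field_simp

/-! ### The extended thermonuclear function -/

theorem I1Integrand_eq {m : ℕ} {α b x : ℝ} (hα : 1 < α) (hb : 0 < b) (hx : 0 < x) :
    I1Integrand ((m : ℝ) + 1 / 2) α b x = (α - 1) ^ (-((m : ℝ) + 1 / 2)) *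
      pathwayIntegrand (((2 * m + 3 : ℕ) : ℝ) / 2) (1 / (α - 1))
        (2 * seriesVar α b ^ ((1 : ℝ) / 2)) ((α - 1) * x) := by
  have hβ : 0 < α - 1 := by linarith
  have hz : 2 * seriesVar α b ^ ((1 : ℝ) / 2) = b * (α - 1) ^ ((1 : ℝ) / 2) := by
    have h1 : seriesVar α b = (α - 1) * (b / 2) ^ 2 := by rw [seriesVar]; ring
    have h2 : ((b / 2) ^ 2) ^ ((1 : ℝ) / 2) = b / 2 := by
      rw [← Real.sqrt_eq_rpow, Real.sqrt_sq (by positivity)]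
    rw [h1, Real.mul_rpow hβ.le (by positivity), h2]
    ring
  have h3 : (α - 1) ^ ((1 : ℝ) / 2) * (α - 1) ^ (-(1 / 2) : ℝ) = 1 := by
    rw [← Real.rpow_add hβ]; norm_num
  have h4 : (α - 1) ^ (-((m : ℝ) + 1 / 2)) * (α - 1) ^ ((m : ℝ) + 1 / 2) = 1 := by
    rw [← Real.rpow_add hβ]; norm_num
  have h5 : -(b * (α - 1) ^ ((1 : ℝ) / 2)) * ((α - 1) ^ (-(1 / 2) : ℝ) * x ^ (-(1 / 2) : ℝ))
      = -b * x ^ (-(1 / 2) : ℝ) := by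
    linear_combination (-b * x ^ (-(1 / 2) : ℝ)) * h3
  rw [I1Integrand, pathwayIntegrand, hz,
    show ((2 * m + 3 : ℕ) : ℝ) / 2 - 1 = m + 1 / 2 by push_cast; ring,
    Real.mul_rpow hβ.le hx.le, Real.mul_rpow hβ.le hx.le, h5]
  linear_combination (-(x ^ ((m : ℝ) + 1 / 2) * (1 + (α - 1) * x) ^ (-(1 / (α - 1)))
    * Real.exp (-b * x ^ (-(1 / 2) : ℝ)))) * h4

/-- The scaling t = (α-1)x contributes (α-1)^{-(m+1/2)} from the integrand and (α-1)^{-1} from dx.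
For real series, summability is absolute convergence. -/
theorem mainTheorem4 (m : ℕ) (α b : ℝ) (hα : 1 < α) (hb : 0 < b)
    (hconv : (m : ℝ) + 3 / 2 < 1 / (α - 1)) :
    IntegrableOn (I1Integrand ((m : ℝ) + 1 / 2) α b) (Ioi 0) ∧
    Summable (hyp1F2Term (1 / (α - 1) - 3 / 2 - m) (1 / 2) (-(1 / 2) - m) (-seriesVar α b)) ∧
    Summable (logTerm m α b) ∧
    I1 ((m : ℝ) + 1 / 2) α b =
      Real.pi ^ (-(1 / 2) : ℝ) / ((α - 1) ^ ((3 : ℝ) / 2 + m) * Real.Gamma (1 / (α - 1))) *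
        (Real.pi ^ ((1 : ℝ) / 2) * Real.Gamma (1 / (α - 1) - 3 / 2 - m) * Real.Gamma (3 / 2 + m)
            * hyp1F2 (1 / (α - 1) - 3 / 2 - m) (1 / 2) (-(1 / 2) - m) (-seriesVar α b)
          - 2 * Real.pi ^ ((1 : ℝ) / 2) * Real.Gamma (1 / (α - 1) - 1 - m) * Real.Gamma (1 + m)
            * seriesVar α b ^ ((1 : ℝ) / 2)
            * ∑ r ∈ Finset.range (m + 1), (-1) ^ r / (r ! : ℝ)
                * (poch (1 / (α - 1) - 1 - m) r / (poch (3 / 2) r * poch (-(m : ℝ)) r))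
                * seriesVar α b ^ r
          + seriesVar α b ^ ((m : ℝ) + 3 / 2) * ∑' r : ℕ, logTerm m α b r) := by
  have hβ : 0 < α - 1 := by linarith
  have hz : 0 < seriesVar α b := by unfold seriesVar; positivity
  have hm : (0 : ℝ) ≤ m := m.cast_nonneg
  have hA : 0 < 1 / (α - 1) := by positivity
  have hlogterm := logSeriesTerm_eq m hz hA
  have hI1 : ∀ x ∈ Ioi (0 : ℝ), I1Integrand ((m : ℝ) + 1 / 2) α b x = _ :=
    fun x hx => I1Integrand_eq hα hb hx
  set A := 1 / (α - 1) with hAdef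
  set z := seriesVar α b with hzdef
  set k := 2 * z ^ ((1 : ℝ) / 2) with hkdef
  have hk : 0 < k := by positivity
  have hn : ((2 * m + 3 : ℕ) : ℝ) / 2 < A := by push_cast; linarith
  have hGA : 0 < Real.Gamma A := Real.Gamma_pos_of_pos hA
  have hpi : 0 < Real.pi ^ (-(1 / 2) : ℝ) := Real.rpow_pos_of_pos Real.pi_pos _
  have hG1 : 0 < Real.Gamma (A - 3 / 2 - m) := Real.Gamma_pos_of_pos (by linarith)
  have hG2 : 0 < Real.Gamma (3 / 2 + (m : ℝ)) := Real.Gamma_pos_of_pos (by positivity)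
  have hseven := (summable_regularCoeff_even hconv k).congr (regularCoeff_even hconv hz)
  have hlog := summable_logSeriesTerm (k := k) (2 * m + 3) hA
  refine ⟨?_, ?_, ?_, ?_⟩
  · have h1 := integrableOn_pathwayIntegrand hA hn hk
    rw [← mul_zero (α - 1), ← integrableOn_Ioi_comp_mul_left_iff _ _ hβ] at h1
    exact IntegrableOn.congr_fun (h1.const_mul _) (fun x hx => (hI1 x hx).symm) measurableSet_Ioi
  -- The gamma prefactor is positive, so summability of the even part of the expansion passes to the
  -- ₁F₂ series.
  · exact (summable_mul_left_iff (by positivity)).1 hseven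
  · have h1 := hlog.congr fun i => hlogterm i
    exact (summable_mul_left_iff (by positivity)).1 h1
  · have hint : I1 ((m : ℝ) + 1 / 2) α b
        = ((α - 1) ^ ((3 : ℝ) / 2 + m))⁻¹ * pathwayExpansion (2 * m + 3) A k := by
      rw [I1, setIntegral_congr_fun measurableSet_Ioi hI1, integral_const_mul,
        integral_comp_mul_left_Ioi _ _ hβ, mul_zero, ← pathwayIntegral_eq (by linarith) hn hk,
        smul_eq_mul, ← mul_assoc, pathwayIntegral, ← Real.rpow_neg_one (α - 1), ← Real.rpow_add hβ,
        ← Real.rpow_neg hβ.le]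
      congr 2
      ring
    have hlogsum : logSeries (2 * m + 3) A k
        = Real.pi ^ (-(1 / 2) : ℝ) / Real.Gamma A * z ^ ((m : ℝ) + 3 / 2) * ∑' i, logTerm m α b i := by
      rw [logSeries, ← tsum_mul_left]
      exact tsum_congr hlogterm
    rw [hint, pathwayExpansion, regularSeries_eq_even_add_odd hconv, tsum_regularCoeff_even hconv hz,
      tsum_regularCoeff_odd hconv hz, hlogsum]
    have hpi2 := pi_rpow_neg_half_mul
    have hβp : 0 < (α - 1) ^ ((3 : ℝ) / 2 + m) := by positivity
    generalize Real.pi ^ (-(1 / 2) : ℝ) = p at hpi2 ⊢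
    generalize Real.pi ^ ((1 : ℝ) / 2) = q at hpi2 ⊢
    generalize hyp1F2 (A - 3 / 2 - m) (1 / 2) (-(1 / 2) - m) (-z) = H
    generalize (∑ r ∈ Finset.range (m + 1), (-1) ^ r / (r ! : ℝ)
                * (poch (A - 1 - m) r / (poch (3 / 2) r * poch (-(m : ℝ)) r)) * z ^ r) = S
    generalize ∑' i, logTerm m α b i = T
    generalize Real.Gamma (A - 1 - m) = G₁
    generalize Real.Gamma (1 + m) = G₂
    generalize Real.Gamma (A - 3 / 2 - m) = G₃
    generalize Real.Gamma (3 / 2 + m) = G₄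
    field_simp
    linear_combination (2 * G₁ * G₂ * z ^ ((1 : ℝ) / 2) * S - G₃ * G₄ * H) * hpi2
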